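/- Let $\Sigma$ be a finite alphabet. A \emph{loset} is a finite totally ordered $\Sigma$-labelled set (up to isomorphism, a word over $\Sigma$). An \emph{iposet} is a finite set $P$ with a labelling $P\to\Sigma$, two strict partial orders, the \emph{precedence} $<$ and the \emph{event order} $\dashrightarrow$, such that any two distinct elements are related by $<$ or by $\dashrightarrow$, and subsets $S_P$ of $<$-minimal and $T_P$ of $<$-maximal elements (the source and target interfaces). It is required to be an interval iposet: there are $b\le e:P\to\mathbb R$ with $x<y\iff e(x)<b(y)$. Elements unrelated by $<$ are \emph{concurrent}. We write $P\sqsubseteq Q$ if there is a bijection $f:P\to Q$ with $f(S_P)=S_Q$, $f(T_P)=T_Q$ that preserves labels, satisfies $f(x)<f(y)\Rightarrow x<y$, and satisfies $x\dashrightarrow y\Rightarrow f(x)\dashrightarrow f(y)$ for concurrent $x,y$. \emph{Ipomsets} are isomorphism classes of iposets, where an isomorphism is a bijection that preserves interfaces and labels, preserves and reflects $<$, and preserves and reflects $\dashrightarrow$ between concurrent elements. The \emph{gluing} $PQ$ is defined if $T_P\cong S_Q$ as losets: it is $P\sqcup Q$ with $T_P$ and $S_Q$ identified along the unique isomorphism,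 with $S_{PQ}=S_P$, $T_{PQ}=T_Q$, event order the transitive closure of the union of both event orders, and $x<y$ iff $x<_Py$, or $x<_Qy$, or $x\in P\setminus T_P$ and $y\in Q\setminus S_Q$. A \emph{language} is a set $L$ of ipomsets such that $P\sqsubseteq Q\in L$ implies $P\in L$; put $P\backslash L=\{Q\mid PQ \text{ is defined and } PQ\in L\}$. A \emph{higher-dimensional automaton} (HDA), not necessarily finite, consists of sets $X[U]$ of cells, one for each loset $U$, face maps $\delta^0_A,\delta^1_A:X[U]\to X[U-A]$ for $A\subseteq U$, with $\delta^\nu_\emptyset=\mathrm{id}$, $\delta^\nu_A\delta^\nu_B=\delta^\nu_{A\cup B}$ and $\delta^\nu_A\delta^\mu_B=\delta^\mu_B\delta^\nu_A$ for disjoint $A,B$, and sets of start and accept cells. A \emph{path} is a finite sequence of cells whose consecutive members are joined by upsteps from $\delta^0_A(x)$ to $x$ or downsteps from $x$ to $\delta^1_A(x)$. For $x\in X[U]$, the event ipomset of such an upstep is the discrete ipomset on $U$ (that is, with empty $<$) with source interface $U-A$ and target interface $U$; that of such a downstep has source interface $U$ and target interface $U-A$; that of a path is the gluing of those of its steps (for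 a one-cell path, $U$ with both interfaces $U$). A path is accepting if it leads from a start cell to an accept cell, and $X$ \emph{recognises} the set of event ipomsets of its accepting paths. A cell is \emph{essential} if it can be reached by a path from a start cell and an accept cell can be reached by a path from it. $X$ is \emph{deterministic} if each $X[U]$ contains at most one start cell and, for all $V$, $A\subseteq V$ and every essential $x\in X[V-A]$, there is at most one essential $y\in X[V]$ with $\delta^0_A(y)=x$. \textbf{Theorem.} A language $L$ is recognised by a deterministic HDA if and only if it is swap-invariant, that is, for all ipomsets $P,Q,P',Q'$: if $PP'\in L$, $QQ'\in L$ and $P\sqsubseteq Q$, then $QP'\in L$. Moreover, $L$ is swap-invariant if and only if for all ipomsets $P\sqsubseteq Q$ with $Q\backslash L\ne\emptyset$ one has $P\backslash L=Q\backslash L$. -/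

import Mathlib

universe u v

namespace HDAut

/-! ### Iposets -/

/-- A (finite, interval) labelled poset with event order and with source and target interfaces,
over the alphabet `α`. The precedence order is `lt` and the event order is `ev`. -/
structure Iposet (α : Type u) where
  carrier : Type
  finite : Finite carrier
  lt : carrier → carrier → Prop
  ev : carrier → carrier → Prop
  src : Set carrier
  tgt : Set carrier
  label : carrier → α
  lt_irrefl : ∀ x, ¬ lt x x
  lt_trans : ∀ x y z, lt x y → lt y z → lt x z
  ev_irrefl : ∀ x, ¬ ev x x
  ev_trans : ∀ x y z, ev x y → ev y z → ev x z
  total : ∀ x y, x ≠ y → lt x y ∨ lt y x ∨ ev x y ∨ ev y x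
  src_min : ∀ s ∈ src, ∀ x, ¬ lt x s
  tgt_max : ∀ t ∈ tgt, ∀ x, ¬ lt t x
  interval : ∃ b e : carrier → ℝ, (∀ x, b x ≤ e x) ∧ ∀ x y, lt x y ↔ e x < b y

namespace Iposet

variable {α : Type u}

/-- Two events are concurrent if they are not related by precedence. -/
def Conc (P : Iposet α) (x y : P.carrier) : Prop := ¬ P.lt x y ∧ ¬ P.lt y x

/-- `P.Subsumed Q` is `P ⊑ Q`: there is a subsumption `P → Q`. -/
def Subsumed (P Q : Iposet α) : Prop :=
  ∃ f : P.carrier ≃ Q.carrier,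
    f '' P.src = Q.src ∧ f '' P.tgt = Q.tgt ∧ (∀ x, Q.label (f x) = P.label x) ∧
    (∀ x y, Q.lt (f x) (f y) → P.lt x y) ∧
    (∀ x y, P.Conc x y → P.ev x y → Q.ev (f x) (f y))

/-- Isomorphism of iposets; ipomsets are the classes of iposets under this relation. -/
def Iso (P Q : Iposet α) : Prop :=
  ∃ f : P.carrier ≃ Q.carrier,
    f '' P.src = Q.src ∧ f '' P.tgt = Q.tgt ∧ (∀ x, Q.label (f x) = P.label x) ∧
    (∀ x y, P.lt x y ↔ Q.lt (f x) (f y)) ∧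
    (∀ x y, P.Conc x y → (P.ev x y ↔ Q.ev (f x) (f y)))

/-- An isomorphism `T_P ≅ S_Q` of losets (there is at most one). -/
structure Match (P Q : Iposet α) where
  toEquiv : P.tgt ≃ Q.src
  label_eq : ∀ t, Q.label (toEquiv t) = P.label t
  ev_iff : ∀ t t' : P.tgt, P.ev t t' ↔ Q.ev (toEquiv t) (toEquiv t')

section Glue

variable (P Q : Iposet α) (f : Match P Q)

/-- The carrier of the gluing: `P ⊔ Q` with each `t ∈ T_P` identified with `f t ∈ S_Q`. -/
abbrev GlueCarrier : Type := P.carrier ⊕ {y : Q.carrier // y ∉ Q.src}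

/-- The canonical map from `P` to the gluing. -/
def inP (x : P.carrier) : GlueCarrier P Q := Sum.inl x

open Classical in
/-- The canonical map from `Q` to the gluing. -/
noncomputable def inQ (y : Q.carrier) : GlueCarrier P Q :=
  if h : y ∈ Q.src then Sum.inl (f.toEquiv.symm ⟨y, h⟩).1 else Sum.inr ⟨y, h⟩

/-- Precedence of the gluing. -/
def glueLt (z w : GlueCarrier P Q) : Prop :=
  (∃ x y, z = inP P Q x ∧ w = inP P Q y ∧ P.lt x y) ∨
  (∃ x y, z = inQ P Q f x ∧ w = inQ P Q f y ∧ Q.lt x y) ∨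
  (∃ x y, z = inP P Q x ∧ w = inQ P Q f y ∧ x ∉ P.tgt ∧ y ∉ Q.src)

/-- The union of the event orders of `P` and `Q`. -/
def glueEvGen (z w : GlueCarrier P Q) : Prop :=
  (∃ x y, z = inP P Q x ∧ w = inP P Q y ∧ P.ev x y) ∨
  (∃ x y, z = inQ P Q f x ∧ w = inQ P Q f y ∧ Q.ev x y)

/-- Labels of the gluing. -/
def glueLabel : GlueCarrier P Q → α := Sum.elim P.label (fun y => Q.label y.1)

theorem inQ_of_mem {y : Q.carrier} (h : y ∈ Q.src) :
    inQ P Q f y = Sum.inl (f.toEquiv.symm ⟨y, h⟩).1 := by simp [inQ, h]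

theorem inQ_of_notMem {y : Q.carrier} (h : y ∉ Q.src) :
    inQ P Q f y = Sum.inr ⟨y, h⟩ := by simp [inQ, h]

theorem inQ_match (t : P.tgt) : inQ P Q f (f.toEquiv t).1 = Sum.inl t.1 := by
  rw [inQ_of_mem P Q f (f.toEquiv t).2]; simp

theorem inQ_eq_inl {y : Q.carrier} {x : P.carrier} (h : inQ P Q f y = Sum.inl x) :
    ∃ hx : x ∈ P.tgt, y = (f.toEquiv ⟨x, hx⟩).1 := by
  by_cases hy : y ∈ Q.src
  · rw [inQ_of_mem P Q f hy] at h
    obtain rfl := Sum.inl.inj h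
    exact ⟨(f.toEquiv.symm ⟨y, hy⟩).2, by simp⟩
  · rw [inQ_of_notMem P Q f hy] at h; simp at h

theorem inQ_eq_inr {y : Q.carrier} {x} (h : inQ P Q f y = Sum.inr x) : y = x.1 := by
  by_cases hy : y ∈ Q.src
  · rw [inQ_of_mem P Q f hy] at h; simp at h
  · rw [inQ_of_notMem P Q f hy] at h; rw [← Sum.inr.inj h]

theorem inQ_injective : Function.Injective (inQ P Q f) := by
  intro y y' h
  cases hz : inQ P Q f y' with
  | inl x =>
    obtain ⟨_, h1⟩ := inQ_eq_inl P Q f (h.trans hz)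
    obtain ⟨_, h2⟩ := inQ_eq_inl P Q f hz
    rw [h1, h2]
  | inr x => rw [inQ_eq_inr P Q f (h.trans hz), inQ_eq_inr P Q f hz]

/-- The gluing is an interval order. -/
theorem glue_interval : ∃ b e : GlueCarrier P Q → ℝ, (∀ z, b z ≤ e z) ∧
    ∀ z w, glueLt P Q f z w ↔ e z < b w := by
  classical
  obtain ⟨bP, eP, hP, hPlt⟩ := P.interval
  obtain ⟨bQ, eQ, hQ, hQlt⟩ := Q.interval
  have := P.finite
  have := Q.finite
  obtain ⟨M, hM⟩ := (Set.finite_range eP).bddAbove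
  obtain ⟨m, hm⟩ := (Set.finite_range bQ).bddBelow
  have hM' : ∀ x, eP x ≤ M := fun x => hM ⟨x, rfl⟩
  have hm' : ∀ x, m ≤ bQ x := fun x => hm ⟨x, rfl⟩
  set c : ℝ := M - m + 1 with hc
  refine ⟨Sum.elim bP (fun y => bQ y.1 + c),
    Sum.elim (fun x => if hx : x ∈ P.tgt then eQ (f.toEquiv ⟨x, hx⟩).1 + c else eP x)
      (fun y => eQ y.1 + c), ?_, ?_⟩
  · rintro (x | y)
    · by_cases hx : x ∈ P.tgt
      · simp only [Sum.elim_inl, hx, dite_true]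
        linarith [hP x, hM' x, hQ (f.toEquiv ⟨x, hx⟩).1, hm' (f.toEquiv ⟨x, hx⟩).1]
      · simpa [hx] using hP x
    · simpa using hQ y.1
  · rintro (x | x) (y | y)
    · by_cases hx : x ∈ P.tgt
      · simp only [Sum.elim_inl, hx, dite_true]
        refine ⟨?_, fun h => ?_⟩
        · rintro (⟨x', y', h1, h2, h⟩ | ⟨x', y', h1, h2, h⟩ | ⟨x', y', h1, h2, h, h'⟩)
          · obtain rfl := Sum.inl.inj h1
            exact (P.tgt_max _ hx _ h).elim
          · obtain ⟨hy, rfl⟩ := inQ_eq_inl P Q f h2.symm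
            exact (Q.src_min _ (f.toEquiv ⟨y, hy⟩).2 _ h).elim
          · obtain ⟨hy, rfl⟩ := inQ_eq_inl P Q f h2.symm
            exact (h' (f.toEquiv ⟨y, hy⟩).2).elim
        · linarith [hP y, hM' y, hQ (f.toEquiv ⟨x, hx⟩).1, hm' (f.toEquiv ⟨x, hx⟩).1]
      · simp only [Sum.elim_inl, hx, dite_false]
        rw [← hPlt]
        refine ⟨?_, fun h => Or.inl ⟨x, y, rfl, rfl, h⟩⟩
        rintro (⟨x', y', h1, h2, h⟩ | ⟨x', y', h1, h2, h⟩ | ⟨x', y', h1, h2, h, h'⟩)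
        · obtain rfl := Sum.inl.inj h1
          obtain rfl := Sum.inl.inj h2
          exact h
        · obtain ⟨hy, _⟩ := inQ_eq_inl P Q f h1.symm
          exact (hx hy).elim
        · obtain ⟨hy, rfl⟩ := inQ_eq_inl P Q f h2.symm
          exact (h' (f.toEquiv ⟨y, hy⟩).2).elim
    · by_cases hx : x ∈ P.tgt
      · simp only [Sum.elim_inl, Sum.elim_inr, hx, dite_true, add_lt_add_iff_right]
        rw [← hQlt]
        refine ⟨?_, fun h => Or.inr (Or.inl ⟨_, _, (inQ_match P Q f ⟨x, hx⟩).symm,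
          (inQ_of_notMem P Q f y.2).symm, h⟩)⟩
        rintro (⟨x', y', h1, h2, h⟩ | ⟨x', y', h1, h2, h⟩ | ⟨x', y', h1, h2, h, h'⟩)
        · simp [inP] at h2
        · obtain ⟨_, rfl⟩ := inQ_eq_inl P Q f h1.symm
          obtain rfl := inQ_eq_inr P Q f h2.symm
          exact h
        · obtain rfl := Sum.inl.inj h1
          exact (h hx).elim
      · simp only [Sum.elim_inl, Sum.elim_inr, hx, dite_false]
        refine ⟨fun _ => by linarith [hM' x, hm' y.1], fun _ => Or.inr (Or.inr
          ⟨x, y.1, rfl, (inQ_of_notMem P Q f y.2).symm, hx, y.2⟩)⟩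
    · simp only [Sum.elim_inl, Sum.elim_inr]
      refine ⟨?_, fun h => ?_⟩
      · rintro (⟨x', y', h1, h2, h⟩ | ⟨x', y', h1, h2, h⟩ | ⟨x', y', h1, h2, h, h'⟩)
        · simp [inP] at h1
        · obtain ⟨hy, rfl⟩ := inQ_eq_inl P Q f h2.symm
          exact (Q.src_min _ (f.toEquiv ⟨y, hy⟩).2 _ h).elim
        · simp [inP] at h1
      · linarith [hP y, hM' y, hQ x.1, hm' x.1]
    · simp only [Sum.elim_inr, add_lt_add_iff_right]
      rw [← hQlt]
      refine ⟨?_, fun h => Or.inr (Or.inl ⟨_, _, (inQ_of_notMem P Q f x.2).symm,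
          (inQ_of_notMem P Q f y.2).symm, h⟩)⟩
      rintro (⟨x', y', h1, h2, h⟩ | ⟨x', y', h1, h2, h⟩ | ⟨x', y', h1, h2, h, h'⟩)
      · simp [inP] at h1
      · obtain rfl := inQ_eq_inr P Q f h1.symm
        obtain rfl := inQ_eq_inr P Q f h2.symm
        exact h
      · simp [inP] at h1

/-- The generated event order, restricted to `P` and to `Q`, is the given one. -/
theorem glueEv_aux {z w : GlueCarrier P Q} (h : Relation.TransGen (glueEvGen P Q f) z w) :
    (∀ x y, z = inP P Q x → w = inP P Q y → P.ev x y) ∧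
    (∀ x y, z = inQ P Q f x → w = inQ P Q f y → Q.ev x y) ∧
    (∀ x y, z = inP P Q x → w = inQ P Q f y → x ∉ P.tgt → y ∉ Q.src →
      ∃ t : P.tgt, P.ev x t ∧ Q.ev (f.toEquiv t) y) ∧
    (∀ x y, z = inQ P Q f x → w = inP P Q y → x ∉ Q.src → y ∉ P.tgt →
      ∃ t : P.tgt, Q.ev x (f.toEquiv t) ∧ P.ev t y) := by
  have hinj := inQ_injective P Q f
  have hov : ∀ x y, inP P Q x = inQ P Q f y → ∃ hx : x ∈ P.tgt, y = (f.toEquiv ⟨x, hx⟩).1 :=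
    fun x y h => inQ_eq_inl P Q f h.symm
  have hQt : ∀ t : P.tgt, inQ P Q f (f.toEquiv t).1 = inP P Q t.1 := inQ_match P Q f
  have hPinj : ∀ x y, inP P Q x = inP P Q y → x = y := fun x y h => Sum.inl.inj h
  have htQ : ∀ y ∈ Q.src, ∃ t : P.tgt, y = (f.toEquiv t).1 := fun y hy =>
    ⟨f.toEquiv.symm ⟨y, hy⟩, by simp⟩
  induction h with
  | single h =>
    rcases h with ⟨x, y, rfl, rfl, h⟩ | ⟨x, y, rfl, rfl, h⟩
    · refine ⟨?_, ?_, ?_, ?_⟩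
      · intro x' y' h1 h2
        rw [← hPinj _ _ h1, ← hPinj _ _ h2]; exact h
      · intro x' y' h1 h2
        obtain ⟨_, rfl⟩ := hov _ _ h1
        obtain ⟨_, rfl⟩ := hov _ _ h2
        exact (f.ev_iff _ _).1 h
      · intro x' y' _ h2 _ h4
        obtain ⟨_, rfl⟩ := hov _ _ h2
        exact (h4 (f.toEquiv _).2).elim
      · intro x' y' h1 _ h3 _
        obtain ⟨_, rfl⟩ := hov _ _ h1
        exact (h3 (f.toEquiv _).2).elim
    · refine ⟨?_, ?_, ?_, ?_⟩
      · intro x' y' h1 h2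
        obtain ⟨_, rfl⟩ := hov _ _ h1.symm
        obtain ⟨_, rfl⟩ := hov _ _ h2.symm
        exact (f.ev_iff ⟨x', _⟩ ⟨y', _⟩).2 h
      · intro x' y' h1 h2
        rw [← hinj h1, ← hinj h2]; exact h
      · intro x' y' h1 _ h3 _
        obtain ⟨h5, _⟩ := hov _ _ h1.symm
        exact (h3 h5).elim
      · intro x' y' _ h2 _ h4
        obtain ⟨h5, _⟩ := hov _ _ h2.symm
        exact (h4 h5).elim
  | @tail w' w _ h ih =>
    obtain ⟨i1, i2, i3, i4⟩ := ih
    rcases h with ⟨c, d, rfl, rfl, h⟩ | ⟨c, d, rfl, rfl, h⟩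
    · have key1 : ∀ x, z = inP P Q x → P.ev x d := fun x hx =>
        P.ev_trans _ _ _ (i1 x c hx rfl) h
      have key2 : ∀ x, z = inQ P Q f x → x ∉ Q.src →
          ∃ t : P.tgt, Q.ev x (f.toEquiv t) ∧ P.ev t d := by
        intro x hx hxs
        by_cases hc : c ∈ P.tgt
        · exact ⟨⟨c, hc⟩, i2 _ _ hx (hQt ⟨c, hc⟩).symm, h⟩
        · obtain ⟨t, h1, h2⟩ := i4 x c hx rfl hxs hc
          exact ⟨t, h1, P.ev_trans _ _ _ h2 h⟩
      refine ⟨?_, ?_, ?_, ?_⟩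
      · intro x y hx hy
        rw [← hPinj _ _ hy]; exact key1 x hx
      · intro x y hx hy
        obtain ⟨hd, rfl⟩ := hov _ _ hy
        by_cases hxs : x ∈ Q.src
        · obtain ⟨t, rfl⟩ := htQ x hxs
          exact (f.ev_iff t ⟨d, hd⟩).1 (key1 t.1 (hx.trans (hQt t)))
        · obtain ⟨t, h1, h2⟩ := key2 x hx hxs
          exact Q.ev_trans _ _ _ h1 ((f.ev_iff t ⟨d, hd⟩).1 h2)
      · intro x y _ hy _ hys
        obtain ⟨_, rfl⟩ := hov _ _ hy
        exact (hys (f.toEquiv _).2).elim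
      · intro x y hx hy hxs _
        rw [← hPinj _ _ hy]; exact key2 x hx hxs
    · have key1 : ∀ x, z = inQ P Q f x → Q.ev x d := fun x hx =>
        Q.ev_trans _ _ _ (i2 x c hx rfl) h
      have key2 : ∀ x, z = inP P Q x → x ∉ P.tgt →
          ∃ t : P.tgt, P.ev x t ∧ Q.ev (f.toEquiv t) d := by
        intro x hx hxs
        by_cases hc : c ∈ Q.src
        · obtain ⟨t, rfl⟩ := htQ c hc
          exact ⟨t, i1 _ _ hx (hQt t), h⟩
        · obtain ⟨t, h1, h2⟩ := i3 x c hx rfl hxs hc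
          exact ⟨t, h1, Q.ev_trans _ _ _ h2 h⟩
      refine ⟨?_, ?_, ?_, ?_⟩
      · intro x y hx hy
        obtain ⟨hd, rfl⟩ := hov _ _ hy.symm
        by_cases hxs : x ∈ P.tgt
        · exact (f.ev_iff ⟨x, hxs⟩ ⟨y, hd⟩).2 (key1 _ (hx.trans (hQt ⟨x, hxs⟩).symm))
        · obtain ⟨t, h1, h2⟩ := key2 x hx hxs
          exact P.ev_trans _ _ _ h1 ((f.ev_iff t ⟨y, hd⟩).2 h2)
      · intro x y hx hy
        rw [← hinj hy]; exact key1 x hx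
      · intro x y hx hy hxs _
        rw [← hinj hy]; exact key2 x hx hxs
      · intro x y _ hy _ hys
        obtain ⟨hd, _⟩ := hov _ _ hy.symm
        exact (hys hd).elim

/-- The gluing `P * Q` along the isomorphism `f : T_P ≅ S_Q`. -/
noncomputable def glue : Iposet α where
  carrier := GlueCarrier P Q
  finite := by
    have := P.finite
    have := Q.finite
    infer_instance
  lt := glueLt P Q f
  ev := Relation.TransGen (glueEvGen P Q f)
  src := inP P Q '' P.src
  tgt := inQ P Q f '' Q.tgt
  label := glueLabel P Q
  lt_irrefl := by
    obtain ⟨b, e, hbe, h⟩ := glue_interval P Q f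
    intro x hx
    linarith [(h x x).1 hx, hbe x]
  lt_trans := by
    obtain ⟨b, e, hbe, h⟩ := glue_interval P Q f
    intro x y z hxy hyz
    exact (h x z).2 (by linarith [(h x y).1 hxy, (h y z).1 hyz, hbe y])
  ev_irrefl := by
    rintro (x | y) h
    · exact P.ev_irrefl x ((glueEv_aux P Q f h).1 x x rfl rfl)
    · exact Q.ev_irrefl y.1 ((glueEv_aux P Q f h).2.1 y.1 y.1
        (inQ_of_notMem P Q f y.2).symm (inQ_of_notMem P Q f y.2).symm)
  ev_trans := fun _ _ _ h h' => h.trans h'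
  total := by
    have hP : ∀ x y, x ≠ y → glueLt P Q f (inP P Q x) (inP P Q y) ∨
        glueLt P Q f (inP P Q y) (inP P Q x) ∨
        Relation.TransGen (glueEvGen P Q f) (inP P Q x) (inP P Q y) ∨
        Relation.TransGen (glueEvGen P Q f) (inP P Q y) (inP P Q x) := by
      intro x y hxy
      rcases P.total x y hxy with h | h | h | h
      · exact Or.inl (Or.inl ⟨_, _, rfl, rfl, h⟩)
      · exact Or.inr (Or.inl (Or.inl ⟨_, _, rfl, rfl, h⟩))
      · exact Or.inr (Or.inr (Or.inl (.single (Or.inl ⟨_, _, rfl, rfl, h⟩))))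
      · exact Or.inr (Or.inr (Or.inr (.single (Or.inl ⟨_, _, rfl, rfl, h⟩))))
    have hQ : ∀ x y, x ≠ y → glueLt P Q f (inQ P Q f x) (inQ P Q f y) ∨
        glueLt P Q f (inQ P Q f y) (inQ P Q f x) ∨
        Relation.TransGen (glueEvGen P Q f) (inQ P Q f x) (inQ P Q f y) ∨
        Relation.TransGen (glueEvGen P Q f) (inQ P Q f y) (inQ P Q f x) := by
      intro x y hxy
      rcases Q.total x y hxy with h | h | h | h
      · exact Or.inl (Or.inr (Or.inl ⟨_, _, rfl, rfl, h⟩))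
      · exact Or.inr (Or.inl (Or.inr (Or.inl ⟨_, _, rfl, rfl, h⟩)))
      · exact Or.inr (Or.inr (Or.inl (.single (Or.inr ⟨_, _, rfl, rfl, h⟩))))
      · exact Or.inr (Or.inr (Or.inr (.single (Or.inr ⟨_, _, rfl, rfl, h⟩))))
    have hPQ : ∀ x, ∀ y : {y : Q.carrier // y ∉ Q.src}, glueLt P Q f (Sum.inl x) (Sum.inr y) ∨
        glueLt P Q f (Sum.inr y) (Sum.inl x) ∨
        Relation.TransGen (glueEvGen P Q f) (Sum.inl x) (Sum.inr y) ∨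
        Relation.TransGen (glueEvGen P Q f) (Sum.inr y) (Sum.inl x) := by
      intro x y
      by_cases hx : x ∈ P.tgt
      · have hne : (f.toEquiv ⟨x, hx⟩).1 ≠ y.1 := fun h => y.2 (h ▸ (f.toEquiv ⟨x, hx⟩).2)
        have := hQ _ _ hne
        rwa [inQ_match, inQ_of_notMem P Q f y.2] at this
      · exact Or.inl (Or.inr (Or.inr ⟨x, y.1, rfl, (inQ_of_notMem P Q f y.2).symm, hx, y.2⟩))
    rintro (x | x) (y | y) hxy
    · exact hP x y (fun h => hxy (by rw [h]))
    · exact hPQ x y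
    · rcases hPQ y x with h | h | h | h
      · exact Or.inr (Or.inl h)
      · exact Or.inl h
      · exact Or.inr (Or.inr (Or.inr h))
      · exact Or.inr (Or.inr (Or.inl h))
    · have := hQ x.1 y.1 (fun h => hxy (by rw [Subtype.ext h]))
      rwa [inQ_of_notMem P Q f x.2, inQ_of_notMem P Q f y.2] at this
  src_min := by
    rintro _ ⟨s, hs, rfl⟩ z (⟨x, y, _, h2, h⟩ | ⟨x, y, _, h2, h⟩ | ⟨x, y, _, h2, _, h⟩)
    · obtain rfl := Sum.inl.inj h2
      exact P.src_min _ hs _ h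
    · obtain ⟨_, rfl⟩ := inQ_eq_inl P Q f h2.symm
      exact Q.src_min _ (f.toEquiv _).2 _ h
    · obtain ⟨_, rfl⟩ := inQ_eq_inl P Q f h2.symm
      exact h (f.toEquiv _).2
  tgt_max := by
    rintro _ ⟨t, ht, rfl⟩ z (⟨x, y, h1, _, h⟩ | ⟨x, y, h1, _, h⟩ | ⟨x, y, h1, _, h, _⟩)
    · obtain ⟨hx, rfl⟩ := inQ_eq_inl P Q f h1
      exact P.tgt_max _ hx _ h
    · obtain rfl := inQ_injective P Q f h1
      exact Q.tgt_max _ ht _ h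
    · obtain ⟨hx, rfl⟩ := inQ_eq_inl P Q f h1
      exact h hx
  interval := glue_interval P Q f

end Glue

/-- The source interface of `P` is isomorphic to the loset `U`. -/
def SrcIs (P : Iposet α) (U : List α) : Prop :=
  ∃ f : Fin U.length ≃ P.src, (∀ k, P.label (f k) = U.get k) ∧
    ∀ k l, k < l ↔ P.ev (f k) (f l)

/-- The target interface of `P` is isomorphic to the loset `U`. -/
def TgtIs (P : Iposet α) (U : List α) : Prop :=
  ∃ f : Fin U.length ≃ P.tgt, (∀ k, P.label (f k) = U.get k) ∧
    ∀ k l, k < l ↔ P.ev (f k) (f l)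

theorem nonempty_match {P Q : Iposet α} {U : List α} (hP : P.TgtIs U) (hQ : Q.SrcIs U) :
    Nonempty (Match P Q) := by
  obtain ⟨f, f1, f2⟩ := hP
  obtain ⟨g, g1, g2⟩ := hQ
  refine ⟨⟨f.symm.trans g, fun t => ?_, fun (t t' : P.tgt) => ?_⟩⟩
  · have := f1 (f.symm t)
    simp only [Equiv.apply_symm_apply] at this
    simp [g1, this]
  · have := f2 (f.symm t) (f.symm t')
    simp only [Equiv.apply_symm_apply] at this
    rw [← this, g2]; rfl

theorem glue_srcIs {P Q : Iposet α} (f : Match P Q) {U : List α} (h : P.SrcIs U) :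
    (glue P Q f).SrcIs U := by
  obtain ⟨g, g1, g2⟩ := h
  refine ⟨g.trans (Equiv.Set.image (inP P Q) P.src Sum.inl_injective), fun k => g1 k,
    fun k l => (g2 k l).trans ⟨fun h => .single (Or.inl ⟨_, _, rfl, rfl, h⟩),
      fun h => (glueEv_aux P Q f h).1 _ _ rfl rfl⟩⟩

theorem glueLabel_inQ {P Q : Iposet α} (f : Match P Q) (y : Q.carrier) :
    glueLabel P Q (inQ P Q f y) = Q.label y := by
  by_cases hy : y ∈ Q.src
  · rw [inQ_of_mem P Q f hy]
    simp [glueLabel, ← f.label_eq]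
  · rw [inQ_of_notMem P Q f hy]; rfl

theorem glue_tgtIs {P Q : Iposet α} (f : Match P Q) {U : List α} (h : Q.TgtIs U) :
    (glue P Q f).TgtIs U := by
  obtain ⟨g, g1, g2⟩ := h
  refine ⟨g.trans (Equiv.Set.image (inQ P Q f) Q.tgt (inQ_injective P Q f)),
    fun k => (glueLabel_inQ f _).trans (g1 k),
    fun k l => (g2 k l).trans ⟨fun h => .single (Or.inr ⟨_, _, rfl, rfl, h⟩),
      fun h => (glueEv_aux P Q f h).2.1 _ _ rfl rfl⟩⟩

/-- The discrete iposet on the loset `U` with source interface `S` and target interface `T`. -/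
def discrete (U : List α) (S T : Set (Fin U.length)) : Iposet α where
  carrier := Fin U.length
  finite := inferInstance
  lt := fun _ _ => False
  ev := fun k l => k < l
  src := S
  tgt := T
  label := U.get
  lt_irrefl := fun _ h => h
  lt_trans := fun _ _ _ h _ => h
  ev_irrefl := fun k => _root_.lt_irrefl k
  ev_trans := fun _ _ _ h h' => _root_.lt_trans h h'
  total := fun _ _ h => Or.inr (Or.inr (lt_or_gt_of_ne h))
  src_min := fun _ _ _ h => h
  tgt_max := fun _ _ _ h => h
  interval := ⟨fun _ => 0, fun _ => 0, fun _ => le_rfl, fun _ _ => by simp⟩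

end Iposet

/-! ### Languages -/

/-- A language over `α`: a set of iposets closed under refinement, `P ⊑ Q ∈ L → P ∈ L`.
Since isomorphic iposets subsume each other, such a set is a union of isomorphism classes,
that is, a set of ipomsets. -/
structure PomLang (α : Type u) where
  carrier : Set (Iposet α)
  down : ∀ P Q : Iposet α, P.Subsumed Q → Q ∈ carrier → P ∈ carrier

namespace PomLang

variable {α : Type u}

/-- `L.HasGlue P Q` says that the gluing `P * Q` is defined and belongs to `L`. -/
def HasGlue (L : PomLang α) (P Q : Iposet α) : Prop :=
  ∃ f : Iposet.Match P Q, Iposet.glue P Q f ∈ L.carrier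

/-- The prefix quotient `P \ L = {Q | P * Q ∈ L}`. -/
def prefixQuotient (L : PomLang α) (P : Iposet α) : Set (Iposet α) :=
  {Q | L.HasGlue P Q}

/-- Swap-invariance: `P P' ∈ L`, `Q Q' ∈ L` and `P ⊑ Q` imply `Q P' ∈ L`. -/
def SwapInvariant (L : PomLang α) : Prop :=
  ∀ P Q P' Q' : Iposet α,
    L.HasGlue P P' → L.HasGlue Q Q' → P.Subsumed Q → L.HasGlue Q P'

end PomLang

/-! ### Higher-dimensional automata

Losets are taken up to isomorphism, hence they are lists of labels: the events of `U : List α`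
are the positions `Fin U.length`, in their natural order. -/

/-- An inclusion of losets `V → U`: a strictly increasing, label-preserving map. A subset
`A ⊆ U` is encoded by the inclusion `U - A → U`; each `A` arises from exactly one `V` and exactly
one inclusion `V → U`, and `A` is the complement of its range. -/
structure Incl {α : Type u} (V U : List α) where
  emb : Fin V.length ↪o Fin U.length
  label_eq : ∀ k, U.get (emb k) = V.get k

namespace Incl

variable {α : Type u}

/-- The identity inclusion (`A = ∅`). -/
def refl (U : List α) : Incl U U := ⟨RelEmbedding.refl _, fun _ => rfl⟩

/-- Composition of inclusions. -/
def trans {W V U : List α} (j : Incl W V) (i : Incl V U) : Incl W U :=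
  ⟨j.emb.trans i.emb, fun k => (i.label_eq (j.emb k)).trans (j.label_eq k)⟩

end Incl

/-- A precubical set. `cell U` is the set `X[U]` of cells with list of active events `U`;
for `i : U - A → U`, `face false i` is the lower face map `δ⁰_A` and `face true i` is the upper
face map `δ¹_A`. -/
structure PrecubicalSet (α : Type u) where
  cell : List α → Type v
  face : Bool → ∀ {V U : List α}, Incl V U → cell U → cell V
  /-- `δ^ν_∅ = id` -/
  face_refl : ∀ (ν : Bool) {U : List α} (x : cell U), face ν (Incl.refl U) x = x
  /-- `δ^ν_A δ^ν_B = δ^ν_{A ∪ B}` for disjoint `A`, `B` -/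
  face_trans : ∀ (ν : Bool) {W V U : List α} (j : Incl W V) (i : Incl V U) (x : cell U),
    face ν j (face ν i x) = face ν (j.trans i) x
  /-- `δ^μ_B δ^ν_A = δ^ν_A δ^μ_B` for disjoint `A`, `B`. Here `V = U - A`, `W = U - B` and
  `Z = U - (A ∪ B)`. -/
  face_comm : ∀ (ν μ : Bool) {Z V W U : List α} (i : Incl V U) (j : Incl W U)
    (j' : Incl Z V) (i' : Incl Z W), j'.trans i = i'.trans j →
    Set.range i.emb ∪ Set.range j.emb = Set.univ →
    Set.range (j'.trans i).emb = Set.range i.emb ∩ Set.range j.emb →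
    ∀ x : cell U, face μ j' (face ν i x) = face ν i' (face μ j x)

/-- A higher-dimensional automaton, not necessarily finite. -/
structure HDA (α : Type u) extends PrecubicalSet.{u, v} α where
  start : ∀ U : List α, Set (cell U)
  accept : ∀ U : List α, Set (cell U)

namespace HDA

variable {α : Type u} (X : HDA.{u, v} α)

/-- A single step `(x, φ, y)`: an upstep starting the events of `A`, where `i : U - A → U` and
`x = δ⁰_A y`, or a downstep terminating the events of `A`, where `y = δ¹_A x`. -/
inductive Step : ∀ {U V : List α}, X.cell U → X.cell V → Type (max u v)
  | up {V U : List α} (i : Incl V U) (x : X.cell V) (y : X.cell U)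
      (h : X.face false i y = x) : Step x y
  | down {V U : List α} (i : Incl V U) (x : X.cell U) (y : X.cell V)
      (h : X.face true i x = y) : Step x y

/-- Paths: finite sequences of consecutive steps. -/
inductive Path : ∀ {U V : List α}, X.cell U → X.cell V → Type (max u v)
  | nil {U : List α} (x : X.cell U) : Path x x
  | cons {U V W : List α} {x : X.cell U} {y : X.cell V} {z : X.cell W}
      (s : X.Step x y) (p : Path y z) : Path x z

variable {X}

/-- The event ipomset of a step: the starter with source interface `U - A`, or the terminator
with target interface `U - A`. -/
def Step.ev {U V : List α} {x : X.cell U} {y : X.cell V} : X.Step x y → Iposet α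
  | .up (U := U) i _ _ _ => Iposet.discrete U (Set.range i.emb) Set.univ
  | .down (U := U) i _ _ _ => Iposet.discrete U Set.univ (Set.range i.emb)

theorem Step.srcIs {U V : List α} {x : X.cell U} {y : X.cell V} (s : X.Step x y) :
    s.ev.SrcIs U := by
  cases s with
  | up i _ _ _ =>
    exact ⟨Equiv.ofInjective _ i.emb.injective, fun k => i.label_eq k,
      fun k l => (i.emb.lt_iff_lt).symm⟩
  | down i _ _ _ => exact ⟨(Equiv.Set.univ _).symm, fun _ => rfl, fun _ _ => Iff.rfl⟩

theorem Step.tgtIs {U V : List α} {x : X.cell U} {y : X.cell V} (s : X.Step x y) :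
    s.ev.TgtIs V := by
  cases s with
  | up i _ _ _ => exact ⟨(Equiv.Set.univ _).symm, fun _ => rfl, fun _ _ => Iff.rfl⟩
  | down i _ _ _ =>
    exact ⟨Equiv.ofInjective _ i.emb.injective, fun k => i.label_eq k,
      fun k l => (i.emb.lt_iff_lt).symm⟩

/-- The event ipomset of a path, together with the fact that its interfaces are the event lists
of the end cells. -/
noncomputable def Path.evAux : ∀ {U V : List α} {x : X.cell U} {y : X.cell V}, X.Path x y →
    {P : Iposet α // P.SrcIs U ∧ P.TgtIs V}
  | U, _, _, _, .nil _ => ⟨Iposet.discrete U Set.univ Set.univ,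
      ⟨(Equiv.Set.univ _).symm, fun _ => rfl, fun _ _ => Iff.rfl⟩,
      ⟨(Equiv.Set.univ _).symm, fun _ => rfl, fun _ _ => Iff.rfl⟩⟩
  | _, _, _, _, .cons s p =>
      ⟨Iposet.glue s.ev p.evAux.1 (Iposet.nonempty_match s.tgtIs p.evAux.2.1).some,
        Iposet.glue_srcIs _ s.srcIs, Iposet.glue_tgtIs _ p.evAux.2.2⟩

/-- The event ipomset of a path: the gluing of the event ipomsets of its steps. -/
noncomputable def Path.ev {U V : List α} {x : X.cell U} {y : X.cell V} (p : X.Path x y) :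
    Iposet α := p.evAux.1

variable (X)

/-- The language of `X`: all iposets isomorphic to the event ipomset of an accepting path. -/
def lang : Set (Iposet α) :=
  {P | ∃ (U V : List α) (x : X.cell U) (y : X.cell V) (p : X.Path x y),
    x ∈ X.start U ∧ y ∈ X.accept V ∧ P.Iso p.ev}

/-- There is a path from a start cell to `x`. -/
def Accessible {U : List α} (x : X.cell U) : Prop :=
  ∃ (V : List α) (s : X.cell V), s ∈ X.start V ∧ Nonempty (X.Path s x)

/-- There is a path from `x` to an accept cell. -/
def Coaccessible {U : List α} (x : X.cell U) : Prop :=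
  ∃ (V : List α) (t : X.cell V), t ∈ X.accept V ∧ Nonempty (X.Path x t)

/-- Essential cells. -/
def Essential {U : List α} (x : X.cell U) : Prop := X.Accessible x ∧ X.Coaccessible x

/-- Deterministic HDAs: at most one start cell of each type, and for each essential `x` of type
`V - A` at most one essential `y` of type `V` with `δ⁰_A y = x`. -/
def Deterministic : Prop :=
  (∀ U : List α, ∀ x ∈ X.start U, ∀ y ∈ X.start U, x = y) ∧
  (∀ (W V : List α) (i : Incl W V) (x : X.cell W), X.Essential x →
    ∀ y y' : X.cell V, X.Essential y → X.Essential y' →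
      X.face false i y = x → X.face false i y' = x → y = y')

end HDA

/-- A language is deterministic if it is recognised by a deterministic HDA. -/
def PomLang.IsDeterministic {α : Type u} (L : PomLang α) : Prop :=
  ∃ X : HDA.{u, v} α, X.Deterministic ∧ X.lang = L.carrier

end HDAut

/-! The theorem is reduced to statements about words of steps.

A word (`Word`) is the shape of a path: a sequence of starters and terminators between losets. A
word is traced on a set of events (`Word.Trace`) by saying which events take part in each step;
the trace is constrained by a relation `lt₁` that has to contain, and a relation `lt₂` that has to
be contained in, the order in which the word performs the events. An iposet with an exact trace
(`Iposet.Spells`) is the gluing of the steps of the word up to isomorphism, and one with a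
trace whose order may exceed that of the iposet (`Iposet.Admits`) subsumes this gluing; both follow
by comparing traces of the same word (`Word.Trace.exists_bijOn`). Traces of two iposets can be put
together to a trace of their gluing (`Iposet.SpellsWith.glue`), and every iposet is spelled by some
word, since an interval order can be scheduled greedily (`Iposet.exists_trace`).

The language of a deterministic automaton is swap-invariant because paths can be deformed: if a path
spells `Q`, if `P ⊑ Q` and if a word `p` spells `P`, then there is a path along `p` with the same
ends (`HDA.Along.of_subsumed`). The deformation follows `p` step by step; if the next step of `p`
starts (terminates) some events, the commutation of the face maps allows the rest of the path to
start (terminate) them first (`HDA.Along.exists_start`, `HDA.Along.exists_terminate`). If `PP'` and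
`QQ'` are recognised and `P ⊑ Q`, then the cell reached after `Q` on a path for `QQ'` is also
reached by a path for `P`. By determinism it is the cell reached after `P` on a path for `PP'`,
hence `QP'` is recognised.

Conversely, let `L` be swap-invariant. After a run `R` that ends with the active events `U`, an
automaton has to know, for each part `V` of `U`, whether the events of `U - V` may be removed from
`R`, and which words complete the resulting run to an element of `L`. Families of such data, subject
to the compatibilities that hold for actual runs, form a precubical set (`ResidualCell`): lower
faces remove active events, upper faces terminate them. Swap-invariance is what makes the set
stable under upper faces, and it implies that a cell with at least one completion is determined by
each of its lower faces in which the removed events were started during the run. So the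
resulting automaton (`residualHDA`) is deterministic. It recognises `L`, because completions of a
cell are exactly the words along which it reaches an accept cell.
-/

namespace HDAut

/-! ### Listings and inclusions of losets -/

section Listing

variable {α : Type u} {E : Type*} {lab : E → α} {ev : E → E → Prop}

/-- `e` enumerates the events of the loset `U` as elements of `E`: it respects labels, and it is
increasing from the order of positions to the relation `ev`. The relation `ev` need not be
transitive: it will be the event order of an iposet, restricted to concurrent events. -/
structure Lists (lab : E → α) (ev : E → E → Prop) (U : List α) (e : Fin U.length → E) : Prop where
  label_eq : ∀ k, lab (e k) = U.get k
  ev_of_lt : ∀ k l, k < l → ev (e k) (e l)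

theorem Lists.injective {U : List α} {e : Fin U.length → E} (h : Lists lab ev U e)
    (hev : ∀ x y, ev x y → ¬ ev y x) : Function.Injective e := by
  intro k l hkl
  by_contra hne
  have irr : ∀ x, ¬ ev x x := fun x hx => hev x x hx hx
  rcases lt_or_gt_of_ne hne with hlt | hlt
  · have := h.ev_of_lt k l hlt
    rw [hkl] at this
    exact irr _ this
  · have := h.ev_of_lt l k hlt
    rw [hkl] at this
    exact irr _ this

theorem Lists.comp {V U : List α} {e : Fin U.length → E} (h : Lists lab ev U e) (i : Incl V U) :
    Lists lab ev V (e ∘ i.emb) :=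
  ⟨fun k => (h.label_eq _).trans (i.label_eq k),
    fun _ _ hkl => h.ev_of_lt _ _ (i.emb.strictMono hkl)⟩

/-- A finite set that is strictly totally ordered by `ev` has a listing. -/
theorem exists_lists (A : Set E) (hA : A.Finite) (hirr : ∀ x ∈ A, ¬ ev x x)
    (htrans : ∀ x ∈ A, ∀ y ∈ A, ∀ z ∈ A, ev x y → ev y z → ev x z)
    (htot : ∀ x ∈ A, ∀ y ∈ A, x ≠ y → ev x y ∨ ev y x) :
    ∃ (U : List α) (e : Fin U.length → E), Lists lab ev U e ∧ Set.range e = A := by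
  classical
  let r : A → A → Prop := fun x y => ev x y
  have : IsStrictTotalOrder A r :=
    { irrefl := fun x => hirr x x.2
      trans := fun x y z => htrans x x.2 y y.2 z z.2
      trichotomous := fun x y h1 h2 => by
        by_contra hne
        rcases htot x x.2 y y.2 (fun h => hne (Subtype.ext h)) with h | h
        · exact h1 h
        · exact h2 h }
  let : LinearOrder A := linearOrderOfSTO r
  have : Fintype A := hA.fintype
  let o : Fin (Fintype.card A) ≃o A := Fintype.orderIsoFinOfCardEq A rfl
  refine ⟨List.ofFn fun k => lab (o k), fun k => o (Fin.cast List.length_ofFn k), ⟨?_, ?_⟩, ?_⟩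
  · intro k
    simp only [List.get_eq_getElem, List.getElem_ofFn]
    rfl
  · intro k l hkl
    have : o (Fin.cast List.length_ofFn k) < o (Fin.cast List.length_ofFn l) :=
      o.strictMono (by simpa using hkl)
    exact this
  · ext x
    constructor
    · rintro ⟨k, rfl⟩
      exact (o _).2
    · intro hx
      exact ⟨Fin.cast List.length_ofFn.symm (o.symm ⟨x, hx⟩), by simp⟩

/-- A listing whose events are among those of another one factors through it. -/
theorem Lists.exists_incl (hev : ∀ x y, ev x y → ¬ ev y x) {V U : List α}
    {e : Fin U.length → E} {d : Fin V.length → E} (he : Lists lab ev U e) (hd : Lists lab ev V d)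
    (h : Set.range d ⊆ Set.range e) : ∃ i : Incl V U, e ∘ i.emb = d := by
  have h' : ∀ k, ∃ l, e l = d k := fun k => h ⟨k, rfl⟩
  choose f hf using h'
  have hmono : StrictMono f := by
    intro k l hkl
    have h1 := hd.ev_of_lt k l hkl
    rcases lt_trichotomy (f k) (f l) with h2 | h2 | h2
    · exact h2
    · rw [← hf, ← hf, h2] at h1
      exact (hev _ _ h1 h1).elim
    · have := he.ev_of_lt _ _ h2
      rw [hf, hf] at this
      exact (hev _ _ h1 this).elim
  refine ⟨⟨OrderEmbedding.ofStrictMono f hmono, fun k => ?_⟩, funext hf⟩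
  rw [← hd.label_eq k, ← hf k, he.label_eq]
  rfl

theorem Incl.ext_emb {V U : List α} {i j : Incl V U} (h : ∀ k, i.emb k = j.emb k) : i = j := by
  obtain ⟨i, _⟩ := i
  obtain ⟨j, _⟩ := j
  congr
  ext k
  exact congrArg _ (h k)

/-- The only surjective inclusions are the identities. -/
theorem Incl.eq_refl_of_surjective {V U : List α} (i : Incl V U)
    (h : Function.Surjective i.emb) :
    (⟨V, i⟩ : Σ V, Incl V U) = ⟨U, Incl.refl U⟩ := by
  have hlen : V.length = U.length := by
    simpa using Fintype.card_congr (Equiv.ofBijective _ ⟨i.emb.injective, h⟩)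
  have hemb : i.emb = (Fin.castOrderIso hlen).toOrderEmbedding := by
    apply OrderEmbedding.range_inj.1
    rw [h.range_eq]
    exact ((Fin.castOrderIso hlen).surjective.range_eq).symm
  have hVU : V = U := by
    apply List.ext_get hlen
    intro n h1 h2
    have := i.label_eq ⟨n, h1⟩
    rw [hemb] at this
    exact this.symm
  subst hVU
  congr
  apply Incl.ext_emb
  intro k
  rw [hemb]
  rfl

/-- A set of events has at most one listing. -/
theorem Lists.ext (hev : ∀ x y, ev x y → ¬ ev y x) {V U : List α}
    {e : Fin U.length → E} {d : Fin V.length → E} (he : Lists lab ev U e) (hd : Lists lab ev V d)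
    (h : Set.range d = Set.range e) :
    (⟨V, d⟩ : Σ V : List α, (Fin V.length → E)) = ⟨U, e⟩ := by
  obtain ⟨i, rfl⟩ := he.exists_incl hev hd h.le
  have hs : Function.Surjective i.emb := by
    intro k
    obtain ⟨l, hl⟩ := h.ge ⟨k, rfl⟩
    exact ⟨l, he.injective hev hl⟩
  obtain ⟨rfl, h⟩ := Sigma.mk.inj_iff.1 (i.eq_refl_of_surjective hs)
  obtain rfl := eq_of_heq h
  rfl

end Listing

namespace Incl

variable {α : Type u}

theorem lists {V U : List α} (i : Incl V U) : Lists U.get (· < ·) V i.emb :=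
  ⟨i.label_eq, fun _ _ h => i.emb.strictMono h⟩

@[simp] theorem refl_trans {V U : List α} (i : Incl V U) : (refl V).trans i = i := rfl

@[simp] theorem trans_refl {V U : List α} (i : Incl V U) : i.trans (refl U) = i := rfl

theorem trans_assoc {Z W V U : List α} (k : Incl Z W) (j : Incl W V) (i : Incl V U) :
    (k.trans j).trans i = k.trans (j.trans i) := rfl

theorem trans_cancel {W V U : List α} {j j' : Incl W V} {i : Incl V U}
    (h : j.trans i = j'.trans i) : j = j' := by
  apply ext_emb
  intro k
  apply i.emb.injective
  exact congrArg (fun t : Incl W U => t.emb k) h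

theorem emb_eq_of_eq {V U : List α} {i j : Incl V U} (h : i = j) (k) : i.emb k = j.emb k := by
  rw [h]

/-- Every subset of a loset is the range of an inclusion. -/
theorem exists_range_eq {U : List α} (s : Set (Fin U.length)) :
    ∃ (V : List α) (i : Incl V U), Set.range i.emb = s := by
  obtain ⟨V, e, he, hs⟩ := exists_lists (lab := U.get) (ev := (· < ·)) s (Set.toFinite s)
    (fun x _ => lt_irrefl x) (fun x _ y _ z _ => lt_trans) (fun x _ y _ => lt_or_gt_of_ne)
  exact ⟨V, ⟨OrderEmbedding.ofStrictMono e fun k l h => he.ev_of_lt k l h, he.label_eq⟩, hs⟩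

theorem exists_factor {W V U : List α} (j : Incl W U) (i : Incl V U)
    (h : Set.range j.emb ⊆ Set.range i.emb) : ∃ k : Incl W V, k.trans i = j := by
  obtain ⟨k, hk⟩ := i.lists.exists_incl (fun x y h => h.not_gt) j.lists h
  exact ⟨k, ext_emb fun l => congrFun hk l⟩

/-- An inclusion is determined by its range, its domain included. -/
theorem eq_of_range_eq {W V U : List α} (j : Incl W U) (i : Incl V U)
    (h : Set.range j.emb = Set.range i.emb) :
    (⟨W, j⟩ : Σ V, Incl V U) = ⟨V, i⟩ := by
  obtain ⟨rfl, h2⟩ := Sigma.mk.inj_iff.1 (i.lists.ext (fun x y h => h.not_gt) j.lists h)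
  congr
  exact ext_emb fun k => congrFun (eq_of_heq h2) k

end Incl

/-! ### Words of steps -/

/-- A word of steps from the loset `U` to the loset `W`: a sequence of starters (`up`) and of
terminators (`down`), that is, the shape of a path without its cells. Steps that start or
terminate no event are allowed. -/
inductive Word {α : Type u} : List α → List α → Type u
  | nil (U : List α) : Word U U
  | up {U V W : List α} (i : Incl U V) (w : Word V W) : Word U W
  | down {U V W : List α} (i : Incl V U) (w : Word V W) : Word U W

namespace Word

variable {α : Type u}

/-- Concatenation of words. -/
def append : ∀ {U V W : List α}, Word U V → Word V W → Word U W
  | _, _, _, .nil _, w' => w'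
  | _, _, _, .up i w, w' => .up i (append w w')
  | _, _, _, .down i w, w' => .down i (append w w')

@[simp] theorem nil_append {U V : List α} (w : Word U V) : (nil U).append w = w := rfl

@[simp] theorem append_nil {U V : List α} (w : Word U V) : w.append (nil V) = w := by
  induction w with
  | nil => rfl
  | up i w ih => rw [append, ih]
  | down i w ih => rw [append, ih]

theorem append_assoc {U V W Z : List α} (p : Word U V) (q : Word V W) (r : Word W Z) :
    (p.append q).append r = p.append (q.append r) := by
  induction p with
  | nil => rfl
  | up i w ih => simp only [append, ih]
  | down i w ih => simp only [append, ih]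

end Word

section Along

variable {α : Type u} (X : HDA.{u, v} α)

/-- `X.Along w x y`: there is a path in `X` from `x` to `y` whose steps spell the word `w`. -/
def HDA.Along : ∀ {U W : List α}, Word U W → X.cell U → X.cell W → Prop
  | _, _, .nil _, x, y => x = y
  | _, _, .up i w, x, y => ∃ z, X.face false i z = x ∧ HDA.Along w z y
  | _, _, .down i w, x, y => HDA.Along w (X.face true i x) y

variable {X}

theorem HDA.along_append {U V W : List α} (p : Word U V) (q : Word V W) (x : X.cell U)
    (z : X.cell W) : X.Along (p.append q) x z ↔ ∃ y, X.Along p x y ∧ X.Along q y z := by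
  induction p with
  | nil => simp [Word.append, Along]
  | up i w ih =>
    simp only [Word.append, Along, ih]
    constructor
    · rintro ⟨a, h, y, h1, h2⟩
      exact ⟨y, ⟨a, h, h1⟩, h2⟩
    · rintro ⟨y, ⟨a, h, h1⟩, h2⟩
      exact ⟨a, h, y, h1, h2⟩
  | down i w ih => simp only [Word.append, Along, ih]

end Along

/-! ### Tracing a word on a set of events -/

namespace Word

variable {α : Type u} {E : Type*}

/-- `w.Trace lab ev lt₁ lt₂ N e g`: the steps of `w` can be performed by the elements of `E`,
starting in the situation where the elements of `N` are not yet started and those listed by `e`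
are active, and ending when all events have been started and those listed by `g` are active.
An event is terminated only if it is `lt₁`-below all the events that are not yet started, and
an event is started only if it is not `lt₂`-above any event that is not yet terminated.
So `lt₂ ⊆ lt ⊆ lt₁` for the order `lt` in which the run of `w` performs the events. -/
def Trace (lab : E → α) (ev lt₁ lt₂ : E → E → Prop) : ∀ {U W : List α}, Word U W →
    Set E → (Fin U.length → E) → (Fin W.length → E) → Prop
  | _, _, .nil _, N, e, g => N = ∅ ∧ g = e
  | _, _, .up (V := V) i w, N, e, g => ∃ e' : Fin V.length → E, Lists lab ev V e' ∧
      e' ∘ i.emb = e ∧ (∀ k, k ∉ Set.range i.emb → e' k ∈ N) ∧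
      (∀ k, k ∉ Set.range i.emb → ∀ c ∈ N ∪ Set.range e, ¬ lt₂ c (e' k)) ∧
      Trace lab ev lt₁ lt₂ w (N \ Set.range e') e' g
  | _, _, .down i w, N, e, g => (∀ k, k ∉ Set.range i.emb → ∀ b ∈ N, lt₁ (e k) b) ∧
      Trace lab ev lt₁ lt₂ w N (e ∘ i.emb) g

variable {lab : E → α} {ev lt₁ lt₂ : E → E → Prop}

/-- An upstep does not change the set of events that are not yet terminated. -/
theorem diff_union_range {U V : List α} {N : Set E} {e' : Fin V.length → E} {i : Incl U V}
    (h : ∀ k, k ∉ Set.range i.emb → e' k ∈ N) :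
    N \ Set.range e' ∪ Set.range e' = N ∪ Set.range (e' ∘ i.emb) := by
  ext x
  constructor
  · rintro (⟨hx, -⟩ | ⟨k, rfl⟩)
    · exact Or.inl hx
    · by_cases hk : k ∈ Set.range i.emb
      · obtain ⟨l, rfl⟩ := hk
        exact Or.inr ⟨l, rfl⟩
      · exact Or.inl (h k hk)
  · rintro (hx | ⟨k, rfl⟩)
    · by_cases hk : x ∈ Set.range e'
      · exact Or.inr hk
      · exact Or.inl ⟨hx, hk⟩
    · exact Or.inr ⟨_, rfl⟩

theorem Trace.range_subset {U W : List α} {w : Word U W} {N : Set E} {e : Fin U.length → E}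
    {g : Fin W.length → E} (h : w.Trace lab ev lt₁ lt₂ N e g) :
    Set.range g ⊆ N ∪ Set.range e := by
  induction w generalizing N with
  | nil =>
    obtain ⟨-, rfl⟩ := h
    exact Set.subset_union_right
  | up i w ih =>
    obtain ⟨e', -, rfl, h1, -, h2⟩ := h
    exact (ih h2).trans (diff_union_range h1).le
  | down i w ih =>
    refine (ih h.2).trans (Set.union_subset_union_right _ ?_)
    rintro _ ⟨k, rfl⟩
    exact ⟨_, rfl⟩

/-- An event that is terminated in the first step of a trace is not active at the end. -/
theorem Trace.terminated_notMem {U V W : List α} {i : Incl V U} {w : Word V W} {N : Set E}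
    {e : Fin U.length → E} {g : Fin W.length → E}
    (h : (down i w).Trace lab ev lt₁ lt₂ N e g) (he : Function.Injective e)
    (hN : Disjoint N (Set.range e)) {k} (hk : k ∉ Set.range i.emb) : e k ∉ Set.range g := by
  intro hg
  rcases h.2.range_subset hg with h1 | ⟨l, hl⟩
  · exact hN.ne_of_mem h1 ⟨k, rfl⟩ rfl
  · exact hk ⟨l, he hl⟩

theorem Trace.mono {lt₁' lt₂' : E → E → Prop} {U W : List α}
    {w : Word U W} {N : Set E} {e : Fin U.length → E} {g : Fin W.length → E}
    (h : w.Trace lab ev lt₁ lt₂ N e g)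
    (h1 : ∀ x y, lt₁ x y → lt₁' x y) (h2 : ∀ x y, lt₂' x y → lt₂ x y) :
    w.Trace lab ev lt₁' lt₂' N e g := by
  induction w generalizing N with
  | nil => exact h
  | up i w ih =>
    obtain ⟨e', a1, a2, a3, a4, a5⟩ := h
    exact ⟨e', a1, a2, a3, fun k hk c hc hlt => a4 k hk c hc (h2 _ _ hlt), ih a5⟩
  | down i w ih => exact ⟨fun k hk b hb => h1 _ _ (h.1 k hk b hb), ih h.2⟩

/-- The trace of a word on `E`, transported along an embedding `φ : E → E'` and followed by a trace
of another word that starts the elements of `M`, is a trace of the concatenation. -/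
theorem Trace.append {E' : Type*} {lab' : E' → α} {ev' lt₁' lt₂' : E' → E' → Prop}
    (hev : ∀ x y, ev x y → ¬ ev y x)
    (φ : E → E') (hφ : Function.Injective φ) (hlab : ∀ x, lab' (φ x) = lab x)
    (hev' : ∀ x y, ev x y → ev' (φ x) (φ y)) (h1 : ∀ x y, lt₁ x y → lt₁' (φ x) (φ y))
    (h2 : ∀ x y, lt₂' (φ x) (φ y) → lt₂ x y) {M : Set E'} (hM : ∀ x, φ x ∉ M)
    (hM2 : ∀ x, ∀ m ∈ M, ¬ lt₂' m (φ x))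
    {U W Z : List α} {w : Word U W} {w' : Word W Z} {N : Set E} {e : Fin U.length → E}
    {g : Fin W.length → E} {h : Fin Z.length → E'}
    (hM1 : ∀ x, x ∉ Set.range g → ∀ m ∈ M, lt₁' (φ x) m)
    (he : Lists lab ev U e) (hN : Disjoint N (Set.range e))
    (hw : w.Trace lab ev lt₁ lt₂ N e g) (hw' : w'.Trace lab' ev' lt₁' lt₂' M (φ ∘ g) h) :
    (w.append w').Trace lab' ev' lt₁' lt₂' (φ '' N ∪ M) (φ ∘ e) h := by
  induction w generalizing N with
  | nil =>
    obtain ⟨rfl, rfl⟩ := hw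
    simpa using hw'
  | up i w ih =>
    obtain ⟨e', a1, rfl, a3, a4, a5⟩ := hw
    refine ⟨φ ∘ e', ⟨fun k => (hlab _).trans (a1.label_eq k),
      fun k l hkl => hev' _ _ (a1.ev_of_lt k l hkl)⟩, rfl, fun k hk => Or.inl ⟨_, a3 k hk, rfl⟩,
      ?_, ?_⟩
    · rintro k hk c ((⟨x, hx, rfl⟩ | hc) | ⟨x, rfl⟩) hlt
      · exact a4 k hk x (Or.inl hx) (h2 _ _ hlt)
      · exact hM2 _ _ hc hlt
      · exact a4 k hk _ (Or.inr ⟨x, rfl⟩) (h2 _ _ hlt)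
    · have key : (φ '' N ∪ M) \ Set.range (φ ∘ e') = φ '' (N \ Set.range e') ∪ M := by
        ext x
        constructor
        · rintro ⟨⟨y, hy, rfl⟩ | hx, hn⟩
          · refine Or.inl ⟨y, ⟨hy, ?_⟩, rfl⟩
            rintro ⟨k, rfl⟩
            exact hn ⟨k, rfl⟩
          · exact Or.inr hx
        · rintro (⟨y, ⟨hy, hn⟩, rfl⟩ | hx)
          · refine ⟨Or.inl ⟨y, hy, rfl⟩, ?_⟩
            rintro ⟨k, hk⟩
            exact hn ⟨k, hφ hk⟩
          · refine ⟨Or.inr hx, ?_⟩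
            rintro ⟨k, rfl⟩
            exact hM _ hx
      rw [key]
      exact ih hM1 a1 Set.disjoint_sdiff_left a5 hw'
  | down i w ih =>
    refine ⟨?_, ?_⟩
    · rintro k hk b (⟨x, hx, rfl⟩ | hb)
      · exact h1 _ _ (hw.1 k hk x hx)
      · exact hM1 _ (hw.terminated_notMem (he.injective hev) hN hk) b hb
    · refine ih hM1 (he.comp i) ?_ hw.2 hw'
      refine hN.mono_right ?_
      rintro _ ⟨l, rfl⟩
      exact ⟨_, rfl⟩

/-- Two traces of the same word match the events they perform, compatibly with all the structure:
pairs in sequence are ordered by `lt₁`, pairs that overlap are unordered by `lt₂`. Induction on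
the word: an upstep does not change the set of remaining events, and before a downstep the
matching is extended by the terminated events. -/
theorem Trace.exists_bijOn {E' : Type*} [Nonempty E'] {lab' : E' → α}
    {ev' lt₁' lt₂' : E' → E' → Prop}
    (hev : ∀ x y, ev x y → ¬ ev y x) (hev' : ∀ x y, ev' x y → ¬ ev' y x)
    {U W : List α} {w : Word U W} {N : Set E} {e : Fin U.length → E} {g : Fin W.length → E}
    {N' : Set E'} {e' : Fin U.length → E'} {g' : Fin W.length → E'}
    (he : Lists lab ev U e) (hN : Disjoint N (Set.range e))
    (he' : Lists lab' ev' U e') (hN' : Disjoint N' (Set.range e'))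
    (hmin : ∀ k, ∀ c ∈ N ∪ Set.range e, ¬ lt₂ c (e k))
    (hmin' : ∀ k, ∀ c ∈ N' ∪ Set.range e', ¬ lt₂' c (e' k))
    (hw : w.Trace lab ev lt₁ lt₂ N e g) (hw' : w.Trace lab' ev' lt₁' lt₂' N' e' g') :
    ∃ f : E → E', f ∘ e = e' ∧ f ∘ g = g' ∧
      Set.BijOn f (N ∪ Set.range e) (N' ∪ Set.range e') ∧
      (∀ x ∈ N ∪ Set.range e, lab' (f x) = lab x) ∧
      (∀ x ∈ N ∪ Set.range e, ∀ y ∈ N ∪ Set.range e, lt₂' (f x) (f y) → lt₁ x y) ∧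
      (∀ x ∈ N ∪ Set.range e, ∀ y ∈ N ∪ Set.range e, lt₂ x y → lt₁' (f x) (f y)) ∧
      (∀ x ∈ N ∪ Set.range e, ∀ y ∈ N ∪ Set.range e, ev x y →
        ev' (f x) (f y) ∨ lt₁ x y ∨ lt₁ y x) := by
  classical
  have listed : ∀ {U : List α} {e : Fin U.length → E} {e' : Fin U.length → E'}
      (_ : Lists lab ev U e) (_ : Lists lab' ev' U e') (f : E → E'), f ∘ e = e' →
      ∀ k l, ev (e k) (e l) → ev' (f (e k)) (f (e l)) := by
    rintro U e e' he he' f rfl k l hkl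
    rcases lt_trichotomy k l with h | rfl | h
    · exact he'.ev_of_lt k l h
    · exact (hev _ _ hkl hkl).elim
    · exact (hev _ _ hkl (he.ev_of_lt _ _ h)).elim
  induction w generalizing N N' with
  | nil U =>
    obtain ⟨rfl, rfl⟩ := hw
    obtain ⟨rfl, rfl⟩ := hw'
    have hf : (Function.extend g g' fun _ => Classical.arbitrary E') ∘ g = g' :=
      funext fun k => (he.injective hev).extend_apply _ _ k
    generalize (Function.extend g g' fun _ => Classical.arbitrary E') = f at hf
    have hf' : ∀ k, f (g k) = g' k := congrFun hf
    simp only [Set.empty_union] at hmin hmin' ⊢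
    refine ⟨f, hf, hf, ⟨?_, ?_, ?_⟩, ?_, ?_, ?_, ?_⟩
    · rintro _ ⟨k, rfl⟩
      exact ⟨k, (hf' k).symm⟩
    · rintro _ ⟨k, rfl⟩ _ ⟨l, rfl⟩ h
      rw [hf', hf'] at h
      rw [he'.injective hev' h]
    · rintro _ ⟨k, rfl⟩
      exact ⟨g k, ⟨k, rfl⟩, hf' k⟩
    · rintro _ ⟨k, rfl⟩
      rw [hf', he'.label_eq, he.label_eq]
    · rintro _ ⟨k, rfl⟩ _ ⟨l, rfl⟩ h
      rw [hf', hf'] at h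
      exact (hmin' _ _ ⟨k, rfl⟩ h).elim
    · rintro _ ⟨k, rfl⟩ _ ⟨l, rfl⟩ h
      exact (hmin _ _ ⟨k, rfl⟩ h).elim
    · rintro _ ⟨k, rfl⟩ _ ⟨l, rfl⟩ h
      exact Or.inl (listed he he' f hf k l h)
  | up i w ih =>
    obtain ⟨d, a1, rfl, a3, a4, a5⟩ := hw
    obtain ⟨d', b1, rfl, b3, b4, b5⟩ := hw'
    have hr := diff_union_range a3
    have hr' := diff_union_range b3
    have := ih a1 Set.disjoint_sdiff_left b1 Set.disjoint_sdiff_left ?_ ?_ a5 b5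
    · rw [hr, hr'] at this
      obtain ⟨f, rfl, h⟩ := this
      exact ⟨f, rfl, h⟩
    · rw [hr]
      intro k
      by_cases hk : k ∈ Set.range i.emb
      · obtain ⟨l, rfl⟩ := hk
        exact hmin l
      · exact a4 k hk
    · rw [hr']
      intro k
      by_cases hk : k ∈ Set.range i.emb
      · obtain ⟨l, rfl⟩ := hk
        exact hmin' l
      · exact b4 k hk
  | down i w ih =>
    have einj := he.injective hev
    have einj' := he'.injective hev'
    have hsub : Set.range (e ∘ i.emb) ⊆ Set.range e := Set.range_comp_subset_range _ _
    have hsub' : Set.range (e' ∘ i.emb) ⊆ Set.range e' := Set.range_comp_subset_range _ _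
    have hS := Set.union_subset_union_right N hsub
    have hS' := Set.union_subset_union_right N' hsub'
    obtain ⟨f₀, f1, f2, f3, f4, f5, f6, f7⟩ := ih (he.comp i) (hN.mono_right hsub) (he'.comp i)
      (hN'.mono_right hsub') (fun k c hc => hmin _ c (hS hc)) (fun k c hc => hmin' _ c (hS' hc))
      hw.2 hw'.2
    obtain ⟨f, hfe, hf0⟩ : ∃ f : E → E', (∀ k, f (e k) = e' k) ∧
        ∀ x ∈ N ∪ Set.range (e ∘ i.emb), f x = f₀ x := by
      refine ⟨Function.extend e e' f₀, einj.extend_apply _ _, ?_⟩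
      rintro x (hx | ⟨k, rfl⟩)
      · exact Function.extend_apply' _ _ _ fun ⟨k, hk⟩ => hN.ne_of_mem hx ⟨k, rfl⟩ hk.symm
      · exact (einj.extend_apply _ _ _).trans (congrFun f1 k).symm
    have hcase : ∀ x ∈ N ∪ Set.range e,
        x ∈ N ∪ Set.range (e ∘ i.emb) ∨ ∃ k, k ∉ Set.range i.emb ∧ x = e k := by
      rintro x (hx | ⟨k, rfl⟩)
      · exact Or.inl (Or.inl hx)
      · by_cases hk : k ∈ Set.range i.emb
        · obtain ⟨l, rfl⟩ := hk
          exact Or.inl (Or.inr ⟨l, rfl⟩)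
        · exact Or.inr ⟨k, hk, rfl⟩
    have hnot : ∀ k, k ∉ Set.range i.emb → e' k ∉ N' ∪ Set.range (e' ∘ i.emb) := by
      rintro k hk (h | ⟨l, hl⟩)
      · exact hN'.ne_of_mem h ⟨k, rfl⟩ rfl
      · exact hk ⟨l, einj' hl⟩
    have hN0 : ∀ x ∈ N, f x ∈ N' := by
      intro x hx
      have h1 := f3.mapsTo (Or.inl hx : x ∈ N ∪ Set.range (e ∘ i.emb))
      rw [hf0 x (Or.inl hx)]
      rcases h1 with h1 | ⟨k, hk⟩
      · exact h1
      · have : f₀ (e (i.emb k)) = f₀ x := (congrFun f1 k).trans hk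
        have := f3.injOn (Or.inr ⟨k, rfl⟩) (Or.inl hx) this
        exact (hN.ne_of_mem hx ⟨_, rfl⟩ this.symm).elim
    refine ⟨f, funext hfe, ?_, ⟨?_, ?_, ?_⟩, ?_, ?_, ?_, ?_⟩
    · rw [← f2]
      exact funext fun k => hf0 _ (hw.2.range_subset ⟨k, rfl⟩)
    · rintro x (hx | ⟨k, rfl⟩)
      · exact Or.inl (hN0 x hx)
      · exact Or.inr ⟨k, (hfe k).symm⟩
    · intro x hx y hy hxy
      rcases hcase x hx with hx | ⟨k, hk, rfl⟩ <;> rcases hcase y hy with hy | ⟨l, hl, rfl⟩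
      · rw [hf0 x hx, hf0 y hy] at hxy
        exact f3.injOn hx hy hxy
      · rw [hf0 x hx, hfe] at hxy
        exact (hnot l hl (hxy ▸ f3.mapsTo hx)).elim
      · rw [hf0 y hy, hfe] at hxy
        exact (hnot k hk (hxy ▸ f3.mapsTo hy)).elim
      · rw [hfe, hfe] at hxy
        rw [einj' hxy]
    · rintro y (hy | ⟨k, rfl⟩)
      · obtain ⟨x, hx, rfl⟩ := f3.surjOn (Or.inl hy)
        exact ⟨x, hS hx, hf0 x hx⟩
      · exact ⟨e k, Or.inr ⟨k, rfl⟩, hfe k⟩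
    · intro x hx
      rcases hcase x hx with hx | ⟨k, hk, rfl⟩
      · rw [hf0 x hx, f4 x hx]
      · rw [hfe, he'.label_eq, he.label_eq]
    · intro x hx y hy hxy
      rcases hcase y hy with hy' | ⟨l, hl, rfl⟩
      · rcases hcase x hx with hx' | ⟨k, hk, rfl⟩
        · rw [hf0 x hx', hf0 y hy'] at hxy
          exact f5 x hx' y hy' hxy
        · rcases hy with hy | ⟨l, rfl⟩
          · exact hw.1 k hk y hy
          · rw [hfe, hfe] at hxy
            exact (hmin' l _ (Or.inr ⟨k, rfl⟩) hxy).elim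
      · rw [hfe] at hxy
        refine (hmin' l _ ?_ hxy).elim
        rcases hx with hx | ⟨k, rfl⟩
        · exact Or.inl (hN0 x hx)
        · exact Or.inr ⟨k, (hfe k).symm⟩
    · intro x hx y hy hxy
      rcases hcase y hy with hy' | ⟨l, hl, rfl⟩
      · rcases hcase x hx with hx' | ⟨k, hk, rfl⟩
        · rw [hf0 x hx', hf0 y hy']
          exact f6 x hx' y hy' hxy
        · rcases hy with hy | ⟨l, rfl⟩
          · rw [hfe]
            exact hw'.1 k hk _ (hN0 y hy)
          · exact (hmin l _ (Or.inr ⟨k, rfl⟩) hxy).elim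
      · exact (hmin l _ hx hxy).elim
    · intro x hx y hy hxy
      rcases hcase x hx with hx' | ⟨k, hk, rfl⟩
      · rcases hcase y hy with hy' | ⟨l, hl, rfl⟩
        · rw [hf0 x hx', hf0 y hy']
          exact f7 x hx' y hy' hxy
        · rcases hx with hx | ⟨k, rfl⟩
          · exact Or.inr (Or.inr (hw.1 l hl x hx))
          · exact Or.inl (listed he he' f (funext hfe) k l hxy)
      · rcases hy with hy | ⟨l, rfl⟩
        · exact Or.inr (Or.inl (hw.1 k hk y hy))
        · exact Or.inl (listed he he' f (funext hfe) k l hxy)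

end Word

open Word

theorem Word.Trace.lists {α : Type u} {E : Type*} {lab : E → α} {ev lt₁ lt₂ : E → E → Prop}
    {U W : List α} {w : Word U W} {N : Set E} {e : Fin U.length → E} {g : Fin W.length → E}
    (h : w.Trace lab ev lt₁ lt₂ N e g) (he : Lists lab ev U e) : Lists lab ev W g := by
  induction w generalizing N with
  | nil =>
    obtain ⟨-, rfl⟩ := h
    exact he
  | up i w ih =>
    obtain ⟨e', h1, -, -, -, h2⟩ := h
    exact ih h2 h1
  | down i w ih => exact ih h.2 (he.comp i)

/-! ### Iposets spelled by words -/

namespace Iposet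

variable {α : Type u}

/-- The event order between concurrent events, the only part of the event order that isomorphisms
and subsumptions take into account. -/
def cev (P : Iposet α) (x y : P.carrier) : Prop := P.Conc x y ∧ P.ev x y

theorem cev_asymm (P : Iposet α) (x y : P.carrier) (h : P.cev x y) : ¬ P.cev y x :=
  fun h' => P.ev_irrefl x (P.ev_trans _ _ _ h.2 h'.2)

theorem cev_total (P : Iposet α) {x y : P.carrier} (h : P.Conc x y) (hne : x ≠ y) :
    P.cev x y ∨ P.cev y x := by
  rcases P.total x y hne with h1 | h1 | h1 | h1
  · exact (h.1 h1).elim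
  · exact (h.2 h1).elim
  · exact Or.inl ⟨h, h1⟩
  · exact Or.inr ⟨h.symm, h1⟩

/-- The word `w` is a run of the whole of `P` between its interfaces, in which an event may be
terminated before another one is started only if the two are related by `lt₁`. -/
def SpellsWith (P : Iposet α) (lt₁ : P.carrier → P.carrier → Prop) {U W : List α}
    (w : Word U W) : Prop :=
  ∃ (e : Fin U.length → P.carrier) (g : Fin W.length → P.carrier),
    Lists P.label P.cev U e ∧ Set.range e = P.src ∧ Set.range g = P.tgt ∧
    w.Trace P.label P.cev lt₁ P.lt P.srcᶜ e g

/-- The precedence order of `P` is that of the word `w`; equivalently, the gluing of the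
steps of `w` is isomorphic to `P`. -/
def Spells (P : Iposet α) {U W : List α} (w : Word U W) : Prop := P.SpellsWith P.lt w

/-- The precedence order of `P` is contained in that of the word `w`; equivalently, the
gluing of the steps of `w` is subsumed by `P`. -/
def Admits (P : Iposet α) {U W : List α} (w : Word U W) : Prop :=
  P.SpellsWith (fun _ _ => True) w

variable {P Q : Iposet α}

theorem Spells.admits {U W : List α} {w : Word U W} (h : P.Spells w) : P.Admits w := by
  obtain ⟨e, g, h1, h2, h3, h4⟩ := h
  exact ⟨e, g, h1, h2, h3, h4.mono (fun _ _ _ => trivial) fun _ _ h => h⟩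

theorem compl_union_range {U : List α} {e : Fin U.length → P.carrier}
    (h : Set.range e = P.src) : P.srcᶜ ∪ Set.range e = Set.univ := by
  rw [h, Set.compl_union_self]

theorem disjoint_compl_range {U : List α} {e : Fin U.length → P.carrier}
    (h : Set.range e = P.src) : Disjoint P.srcᶜ (Set.range e) := by
  rw [h]
  exact disjoint_compl_left

theorem isEmpty_of_spellsWith {l : P.carrier → P.carrier → Prop} {U W : List α} {w : Word U W}
    {l' : Q.carrier → Q.carrier → Prop} (hP : P.SpellsWith l w) (hQ : Q.SpellsWith l' w)
    [IsEmpty Q.carrier] : IsEmpty P.carrier := by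
  obtain ⟨e, g, e1, e2, e3, e4⟩ := hP
  obtain ⟨e', g', e1', e2', e3', e4'⟩ := hQ
  by_contra hne
  rw [not_isEmpty_iff] at hne
  obtain ⟨f, -, -, hb, -⟩ := e4'.exists_bijOn Q.cev_asymm P.cev_asymm e1'
    (disjoint_compl_range e2') e1 (disjoint_compl_range e2) (fun k => isEmptyElim (e' k))
    (fun k c _ => P.src_min _ (e2 ▸ ⟨k, rfl⟩) c) e4
  rw [compl_union_range e2, compl_union_range e2'] at hb
  obtain ⟨x⟩ := hne
  obtain ⟨y, -, -⟩ := hb.surjOn (Set.mem_univ x)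
  exact isEmptyElim y

/-- Two iposets with runs along the same word have the same events. -/
theorem exists_equiv_of_spellsWith {l : P.carrier → P.carrier → Prop} {U W : List α} {w : Word U W}
    {l' : Q.carrier → Q.carrier → Prop} (hP : P.SpellsWith l w) (hQ : Q.SpellsWith l' w) :
    ∃ f : P.carrier ≃ Q.carrier,
      f '' P.src = Q.src ∧ f '' P.tgt = Q.tgt ∧ (∀ x, Q.label (f x) = P.label x) ∧
      (∀ x y, Q.lt (f x) (f y) → l x y) ∧ (∀ x y, P.lt x y → l' (f x) (f y)) ∧
      (∀ x y, P.cev x y → Q.cev (f x) (f y) ∨ l x y ∨ l y x) := by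
  rcases isEmpty_or_nonempty Q.carrier with hE | hE
  · have := isEmpty_of_spellsWith hP hQ
    exact ⟨Equiv.equivOfIsEmpty _ _, Subsingleton.elim _ _, Subsingleton.elim _ _,
      isEmptyElim, isEmptyElim, isEmptyElim, isEmptyElim⟩
  · obtain ⟨e, g, e1, e2, e3, e4⟩ := hP
    obtain ⟨e', g', e1', e2', e3', e4'⟩ := hQ
    obtain ⟨f, fe, fg, hb, hl, h1, h2, h3⟩ := e4.exists_bijOn P.cev_asymm Q.cev_asymm e1
      (disjoint_compl_range e2) e1' (disjoint_compl_range e2')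
      (fun k c _ => P.src_min _ (e2 ▸ ⟨k, rfl⟩) c) (fun k c _ => Q.src_min _ (e2' ▸ ⟨k, rfl⟩) c)
      e4'
    rw [compl_union_range e2, compl_union_range e2', Set.bijOn_univ] at hb
    rw [compl_union_range e2] at hl h1 h2 h3
    refine ⟨Equiv.ofBijective f hb, ?_, ?_, fun x => hl x trivial,
      fun x y => h1 x trivial y trivial, fun x y => h2 x trivial y trivial,
      fun x y => h3 x trivial y trivial⟩
    · rw [← e2, ← e2', ← fe, Set.range_comp]
      rfl
    · rw [← e3, ← e3', ← fg, Set.range_comp]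
      rfl

theorem Spells.subsumed {U W : List α} {w : Word U W} (hP : P.Spells w) (hQ : Q.Admits w) :
    P.Subsumed Q := by
  obtain ⟨f, h1, h2, h3, h4, -, h6⟩ := exists_equiv_of_spellsWith hP hQ
  refine ⟨f, h1, h2, h3, h4, fun x y hc hxy => ?_⟩
  rcases h6 x y ⟨hc, hxy⟩ with h | h | h
  · exact h.2
  · exact (hc.1 h).elim
  · exact (hc.2 h).elim

theorem Spells.iso {U W : List α} {w : Word U W} (hP : P.Spells w) (hQ : Q.Spells w) :
    P.Iso Q := by
  obtain ⟨f, h1, h2, h3, h4, h5, h6⟩ := exists_equiv_of_spellsWith hP hQ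
  have key : ∀ x y, P.Conc x y → P.ev x y → Q.cev (f x) (f y) := by
    intro x y hc hxy
    rcases h6 x y ⟨hc, hxy⟩ with h | h | h
    · exact h
    · exact (hc.1 h).elim
    · exact (hc.2 h).elim
  refine ⟨f, h1, h2, h3, fun x y => ⟨h5 x y, h4 x y⟩, fun x y hc => ⟨fun h => (key x y hc h).2, ?_⟩⟩
  intro h
  have hne : x ≠ y := fun hxy => Q.ev_irrefl (f x) (by rw [← hxy] at h; exact h)
  rcases P.total x y hne with h' | h' | h' | h'
  · exact (hc.1 h').elim
  · exact (hc.2 h').elim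
  · exact h'
  · exact (Q.ev_irrefl _ (Q.ev_trans _ _ _ h (key y x hc.symm h').2)).elim

theorem Iso.subsumed (h : P.Iso Q) : P.Subsumed Q := by
  obtain ⟨f, h1, h2, h3, h4, h5⟩ := h
  exact ⟨f, h1, h2, h3, fun x y => (h4 x y).2, fun x y hc => (h5 x y hc).1⟩

theorem cev_of_subsumption {f : P.carrier ≃ Q.carrier} (h4 : ∀ x y, Q.lt (f x) (f y) → P.lt x y)
    (h5 : ∀ x y, P.Conc x y → P.ev x y → Q.ev (f x) (f y)) (x y : P.carrier) (h : P.cev x y) :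
    Q.cev (f x) (f y) :=
  ⟨⟨fun h' => h.1.1 (h4 _ _ h'), fun h' => h.1.2 (h4 _ _ h')⟩, h5 x y h.1 h.2⟩

theorem image_compl_src {f : P.carrier ≃ Q.carrier} (h1 : f '' P.src = Q.src) :
    f '' P.srcᶜ = Q.srcᶜ := by
  rw [← h1, Set.image_compl_eq f.bijective]

theorem Subsumed.admits {U W : List α} {w : Word U W} (h : P.Subsumed Q) (hP : P.Spells w) :
    Q.Admits w := by
  obtain ⟨f, h1, h2, h3, h4, h5⟩ := h
  obtain ⟨e, g, e1, e2, e3, e4⟩ := hP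
  have hc := cev_of_subsumption h4 h5
  refine ⟨f ∘ e, f ∘ g, ⟨fun k => (h3 _).trans (e1.label_eq k),
    fun k l hkl => hc _ _ (e1.ev_of_lt k l hkl)⟩, ?_, ?_, ?_⟩
  · rw [Set.range_comp, e2, h1]
  · rw [Set.range_comp, e3, h2]
  · have := e4.append (lab' := Q.label) (ev' := Q.cev) (lt₁' := fun _ _ => True) (lt₂' := Q.lt)
      (M := ∅) (w' := nil W) (h := f ∘ g) P.cev_asymm f f.injective h3 hc (fun _ _ _ => trivial)
      h4 (fun _ h => h) (fun _ _ h => h.elim) (fun _ _ _ h => h.elim) e1 (disjoint_compl_range e2)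
      ⟨rfl, rfl⟩
    simpa [image_compl_src h1] using this

/-! ### Words of gluings -/

section Glue

variable (P Q) (f : Match P Q)

theorem glueLt_inP (x y : P.carrier) : glueLt P Q f (inP P Q x) (inP P Q y) ↔ P.lt x y := by
  refine ⟨?_, fun h => Or.inl ⟨x, y, rfl, rfl, h⟩⟩
  rintro (⟨a, b, h1, h2, h⟩ | ⟨a, b, h1, h2, h⟩ | ⟨a, b, h1, h2, -, h⟩)
  · rwa [Sum.inl.inj h1, Sum.inl.inj h2]
  · obtain ⟨hy, rfl⟩ := inQ_eq_inl P Q f h2.symm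
    exact (Q.src_min _ (f.toEquiv _).2 _ h).elim
  · obtain ⟨hy, rfl⟩ := inQ_eq_inl P Q f h2.symm
    exact (h (f.toEquiv _).2).elim

theorem glueLt_inQ (x y : Q.carrier) :
    glueLt P Q f (inQ P Q f x) (inQ P Q f y) ↔ Q.lt x y := by
  refine ⟨?_, fun h => Or.inr (Or.inl ⟨x, y, rfl, rfl, h⟩)⟩
  rintro (⟨a, b, h1, h2, h⟩ | ⟨a, b, h1, h2, h⟩ | ⟨a, b, h1, h2, h, -⟩)
  · obtain ⟨hy, -⟩ := inQ_eq_inl P Q f h1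
    exact (P.tgt_max _ hy _ h).elim
  · rwa [inQ_injective P Q f h1, inQ_injective P Q f h2]
  · obtain ⟨hy, -⟩ := inQ_eq_inl P Q f h1
    exact (h hy).elim

theorem not_glueLt_inQ_inP {x : P.carrier} {y : Q.carrier} (hy : y ∉ Q.src) :
    ¬ glueLt P Q f (inQ P Q f y) (inP P Q x) := by
  have hsrc : ∀ a, inQ P Q f y ≠ inP P Q a := by
    intro a ha
    obtain ⟨_, rfl⟩ := inQ_eq_inl P Q f ha
    exact hy (f.toEquiv _).2
  rintro (⟨a, b, h1, h2, h⟩ | ⟨a, b, h1, h2, h⟩ | ⟨a, b, h1, h2, h, -⟩)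
  · exact hsrc _ h1
  · obtain ⟨_, rfl⟩ := inQ_eq_inl P Q f h2.symm
    exact Q.src_min _ (f.toEquiv _).2 _ h
  · exact hsrc _ h1

theorem cev_inP (x y : P.carrier) (h : P.cev x y) :
    (glue P Q f).cev (inP P Q x) (inP P Q y) := by
  refine ⟨⟨?_, ?_⟩, .single (Or.inl ⟨x, y, rfl, rfl, h.2⟩)⟩
  · exact (glueLt_inP P Q f x y).not.2 h.1.1
  · exact (glueLt_inP P Q f y x).not.2 h.1.2

theorem cev_inQ (x y : Q.carrier) (h : Q.cev x y) :
    (glue P Q f).cev (inQ P Q f x) (inQ P Q f y) := by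
  refine ⟨⟨?_, ?_⟩, .single (Or.inr ⟨x, y, rfl, rfl, h.2⟩)⟩
  · exact (glueLt_inQ P Q f x y).not.2 h.1.1
  · exact (glueLt_inQ P Q f y x).not.2 h.1.2

theorem image_inP_tgt : inP P Q '' P.tgt = inQ P Q f '' Q.src := by
  ext z
  constructor
  · rintro ⟨x, hx, rfl⟩
    exact ⟨_, (f.toEquiv ⟨x, hx⟩).2, inQ_match P Q f ⟨x, hx⟩⟩
  · rintro ⟨y, hy, rfl⟩
    exact ⟨_, (f.toEquiv.symm ⟨y, hy⟩).2, (inQ_of_mem P Q f hy).symm⟩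

theorem compl_image_inP_src :
    (inP P Q '' P.src)ᶜ = inP P Q '' P.srcᶜ ∪ inQ P Q f '' Q.srcᶜ := by
  ext z
  constructor
  · intro hz
    rcases z with x | y
    · exact Or.inl ⟨x, fun h => hz ⟨x, h, rfl⟩, rfl⟩
    · exact Or.inr ⟨y.1, y.2, inQ_of_notMem P Q f y.2⟩
  · rintro (⟨x, hx, rfl⟩ | ⟨y, hy, rfl⟩) ⟨a, ha, h⟩
    · rw [Sum.inl.inj h] at ha
      exact hx ha
    · obtain ⟨_, rfl⟩ := inQ_eq_inl P Q f h.symm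
      exact hy (f.toEquiv _).2

variable {P Q f}

theorem lists_inP {U : List α} {e : Fin U.length → P.carrier} (h : Lists P.label P.cev U e) :
    Lists (glue P Q f).label (glue P Q f).cev U (inP P Q ∘ e) :=
  ⟨h.label_eq, fun k l hkl => cev_inP P Q f _ _ (h.ev_of_lt k l hkl)⟩

theorem lists_inQ {U : List α} {e : Fin U.length → Q.carrier} (h : Lists Q.label Q.cev U e) :
    Lists (glue P Q f).label (glue P Q f).cev U (inQ P Q f ∘ e) :=
  ⟨fun k => (glueLabel_inQ f _).trans (h.label_eq k),
    fun k l hkl => cev_inQ P Q f _ _ (h.ev_of_lt k l hkl)⟩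

/-- Words of iposets that can be glued can be concatenated. -/
theorem listing_eq_of_match {l : P.carrier → P.carrier → Prop} {U W W' V : List α} {w : Word U W}
    {l' : Q.carrier → Q.carrier → Prop} {w' : Word W' V} (f : Match P Q)
    (hP : P.SpellsWith l w) (hQ : Q.SpellsWith l' w') : W = W' := by
  obtain ⟨e, g, e1, e2, e3, e4⟩ := hP
  obtain ⟨e', g', e1', e2', e3', e4'⟩ := hQ
  have hr : Set.range (inQ P Q f ∘ e') = Set.range (inP P Q ∘ g) := by
    rw [Set.range_comp, Set.range_comp, e3, e2', image_inP_tgt P Q f]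
  have := (lists_inP (f := f) (e4.lists e1)).ext (glue P Q f).cev_asymm (lists_inQ e1') hr
  exact (Sigma.mk.inj_iff.1 this).1.symm

theorem nonempty_match_of_spells {l : P.carrier → P.carrier → Prop} {U W V : List α} {w : Word U W}
    {l' : Q.carrier → Q.carrier → Prop} {w' : Word W V}
    (hP : P.SpellsWith l w) (hQ : Q.SpellsWith l' w') : Nonempty (Match P Q) := by
  have key : ∀ (R : Iposet α) (s : Set R.carrier) (e : Fin W.length → R.carrier),
      Lists R.label R.cev W e → Set.range e = s → ∃ f : Fin W.length ≃ s,
        (∀ k, R.label (f k) = W.get k) ∧ ∀ k l, k < l ↔ R.ev (f k) (f l) := by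
    rintro R _ e he rfl
    refine ⟨Equiv.ofInjective e (he.injective R.cev_asymm), he.label_eq,
      fun k l => ⟨fun h => (he.ev_of_lt k l h).2, fun h => ?_⟩⟩
    rcases lt_trichotomy k l with h' | rfl | h'
    · exact h'
    · exact (R.ev_irrefl _ h).elim
    · exact (R.ev_irrefl _ (R.ev_trans _ _ _ h (he.ev_of_lt _ _ h').2)).elim
  obtain ⟨e, g, e1, e2, e3, e4⟩ := hP
  obtain ⟨e', g', e1', e2', e3', e4'⟩ := hQ
  exact nonempty_match (key P _ g (e4.lists e1) e3) (key Q _ e' e1' e2')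

theorem SpellsWith.glue {l : P.carrier → P.carrier → Prop} {U W V : List α} {w : Word U W}
    {l' : Q.carrier → Q.carrier → Prop} {w' : Word W V} (f : Match P Q)
    {l₁ : GlueCarrier P Q → GlueCarrier P Q → Prop}
    (hP : P.SpellsWith l w) (hQ : Q.SpellsWith l' w')
    (h1 : ∀ x y, l x y → l₁ (inP P Q x) (inP P Q y))
    (h2 : ∀ x y, l' x y → l₁ (inQ P Q f x) (inQ P Q f y))
    (h3 : ∀ x y, x ∉ P.tgt → y ∉ Q.src → l₁ (inP P Q x) (inQ P Q f y)) :
    (glue P Q f).SpellsWith l₁ (w.append w') := by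
  obtain ⟨e, g, e1, e2, e3, e4⟩ := hP
  obtain ⟨e', g', e1', e2', e3', e4'⟩ := hQ
  have hge : inP P Q ∘ g = inQ P Q f ∘ e' := by
    have hr : Set.range (inQ P Q f ∘ e') = Set.range (inP P Q ∘ g) := by
      rw [Set.range_comp, Set.range_comp, e3, e2', image_inP_tgt P Q f]
    have := (lists_inP (f := f) (e4.lists e1)).ext (Iposet.glue P Q f).cev_asymm (lists_inQ e1') hr
    exact (eq_of_heq (Sigma.mk.inj_iff.1 this).2).symm
  have t' : w'.Trace (E := GlueCarrier P Q) (glueLabel P Q) (Iposet.glue P Q f).cev l₁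
      (glueLt P Q f) (inQ P Q f '' Q.srcᶜ) (inP P Q ∘ g) (inQ P Q f ∘ g') := by
    -- The events of `T_P` are listed by `g` in `P` and by `e'` in `Q`.
    rw [hge]
    have := e4'.append (E' := GlueCarrier P Q) (lab' := glueLabel P Q)
      (ev' := (Iposet.glue P Q f).cev) (lt₁' := l₁) (lt₂' := glueLt P Q f)
      (M := ∅) (w' := nil V) (h := inQ P Q f ∘ g') Q.cev_asymm (inQ P Q f) (inQ_injective P Q f)
      (glueLabel_inQ f) (cev_inQ P Q f) h2
      (fun x y => (glueLt_inQ P Q f x y).1) (fun _ h => h) (fun _ _ h => h.elim)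
      (fun _ _ _ h => h.elim) e1' (disjoint_compl_range e2') ⟨rfl, rfl⟩
    rwa [append_nil, Set.union_empty] at this
  refine ⟨inP P Q ∘ e, inQ P Q f ∘ g', lists_inP e1, ?_, ?_, ?_⟩
  · exact (Set.range_comp _ _).trans (congrArg (Set.image (inP P Q)) e2)
  · exact (Set.range_comp _ _).trans (congrArg (Set.image (inQ P Q f)) e3')
  · have t := e4.append (E' := GlueCarrier P Q) (lab' := glueLabel P Q)
      (ev' := (Iposet.glue P Q f).cev) (lt₁' := l₁) (lt₂' := glueLt P Q f)
      (M := inQ P Q f '' Q.srcᶜ)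
      P.cev_asymm (inP P Q) Sum.inl_injective
      (fun _ => rfl) (cev_inP P Q f) h1 (fun x y => (glueLt_inP P Q f x y).1) ?_ ?_ ?_ e1
      (disjoint_compl_range e2) t'
    · rw [← compl_image_inP_src P Q f] at t
      exact t
    · rintro x ⟨y, hy, h⟩
      obtain ⟨_, rfl⟩ := inQ_eq_inl P Q f h
      exact hy (f.toEquiv _).2
    · rintro x _ ⟨y, hy, rfl⟩
      exact not_glueLt_inQ_inP P Q f hy
    · rintro x hx _ ⟨y, hy, rfl⟩
      exact h3 x y (e3 ▸ hx) hy

theorem Spells.glue {U W V : List α} {w : Word U W} {w' : Word W V} (f : Match P Q)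
    (hP : P.Spells w) (hQ : Q.Spells w') : (glue P Q f).Spells (w.append w') :=
  SpellsWith.glue f hP hQ (fun x y => (glueLt_inP P Q f x y).2)
    (fun x y => (glueLt_inQ P Q f x y).2) fun x y hx hy => Or.inr (Or.inr ⟨x, y, rfl, rfl, hx, hy⟩)

theorem Admits.glue {U W V : List α} {w : Word U W} {w' : Word W V} (f : Match P Q)
    (hP : P.Admits w) (hQ : Q.Admits w') : (glue P Q f).Admits (w.append w') :=
  SpellsWith.glue f hP hQ (fun _ _ h => h) (fun _ _ h => h) fun _ _ _ _ => trivial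

end Glue

/-- A subsumption preserves the losets of the interfaces. -/
theorem Subsumed.listing_eq {l : P.carrier → P.carrier → Prop} {U W U' W' : List α} {w : Word U W}
    {l' : Q.carrier → Q.carrier → Prop} {w' : Word U' W'} (h : P.Subsumed Q)
    (hP : P.SpellsWith l w) (hQ : Q.SpellsWith l' w') : U = U' ∧ W = W' := by
  obtain ⟨f, h1, h2, h3, h4, h5⟩ := h
  obtain ⟨e, g, e1, e2, e3, e4⟩ := hP
  obtain ⟨e', g', e1', e2', e3', e4'⟩ := hQ
  have hc := cev_of_subsumption h4 h5
  have key : ∀ (U U' : List α) (e : Fin U.length → P.carrier) (e' : Fin U'.length → Q.carrier),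
      Lists P.label P.cev U e → Lists Q.label Q.cev U' e' → f '' Set.range e = Set.range e' →
      U = U' := by
    intro U U' e e' he he' h
    have hl : Lists Q.label Q.cev U (f ∘ e) := ⟨fun k => (h3 _).trans (he.label_eq k),
      fun k l hkl => hc _ _ (he.ev_of_lt k l hkl)⟩
    exact (Sigma.mk.inj_iff.1 (he'.ext Q.cev_asymm hl (by rw [Set.range_comp, h]))).1
  exact ⟨key U U' e e' e1 e1' (by rw [e2, e2', h1]),
    key W W' g g' (e4.lists e1) (e4'.lists e1') (by rw [e3, e3', h2])⟩

end Iposet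

/-! ### Every iposet is spelled by a word -/

namespace Iposet

variable {α : Type u}

/-- Greedy scheduling: start an event whenever possible, and otherwise terminate an event that
precedes all those that are not yet started. In an interval order, if no event can be started, the
remaining event whose interval ends first is of this kind. -/
theorem exists_trace (P : Iposet α) {U : List α} {N : Set P.carrier} {e : Fin U.length → P.carrier}
    (he : Lists P.label P.cev U e) (hN : Disjoint N (Set.range e))
    (hmin : ∀ k, ∀ c ∈ N ∪ Set.range e, ¬ P.lt c (e k)) (htgt : P.tgt ⊆ N ∪ Set.range e) :
    ∃ (W : List α) (w : Word U W) (g : Fin W.length → P.carrier),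
      w.Trace P.label P.cev P.lt P.lt N e g ∧ Set.range g = P.tgt := by
  have := P.finite
  induction hn : 2 * N.ncard + U.length using Nat.strong_induction_on generalizing U N with
  | _ n ih =>
  subst hn
  have hinj := he.injective P.cev_asymm
  by_cases hA : ∃ a ∈ N, ∀ c ∈ N ∪ Set.range e, ¬ P.lt c a
  · obtain ⟨a, haN, ha⟩ := hA
    have hsub : insert a (Set.range e) ⊆ N ∪ Set.range e :=
      Set.insert_subset (Or.inl haN) Set.subset_union_right
    have hlow : ∀ x ∈ insert a (Set.range e), ∀ c ∈ N ∪ Set.range e, ¬ P.lt c x := by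
      rintro x (rfl | ⟨k, rfl⟩)
      · exact ha
      · exact hmin k
    have hconc : ∀ x ∈ insert a (Set.range e), ∀ y ∈ insert a (Set.range e), P.Conc x y :=
      fun x hx y hy => ⟨hlow y hy x (hsub hx), hlow x hx y (hsub hy)⟩
    obtain ⟨V, e', he', hr⟩ := exists_lists (lab := P.label) (ev := P.cev)
      (insert a (Set.range e)) (Set.toFinite _) (fun x _ h => P.ev_irrefl x h.2)
      (fun x hx y _ z hz h h' => ⟨hconc x hx z hz, P.ev_trans _ _ _ h.2 h'.2⟩)
      (fun x hx y hy hne => P.cev_total (hconc x hx y hy) hne)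
    obtain ⟨i, rfl⟩ := he'.exists_incl P.cev_asymm he (by rw [hr]; exact Set.subset_insert _ _)
    have hnew : ∀ k, k ∉ Set.range i.emb → e' k = a := by
      intro k hk
      have : e' k ∈ insert a (Set.range (e' ∘ i.emb)) := hr ▸ ⟨k, rfl⟩
      rcases this with h | ⟨l, hl⟩
      · exact h
      · exact (hk ⟨l, he'.injective P.cev_asymm hl⟩).elim
    have hnew' : ∀ k, k ∉ Set.range i.emb → e' k ∈ N := fun k hk => hnew k hk ▸ haN
    have hun := diff_union_range hnew'
    have hlen : V.length ≤ U.length + 1 := by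
      have h1 : (Set.range e').ncard = V.length := by
        rw [← Set.image_univ, Set.ncard_image_of_injective _ (he'.injective P.cev_asymm),
          Set.ncard_univ, Nat.card_eq_fintype_card, Fintype.card_fin]
      have h2 : (Set.range (e' ∘ i.emb)).ncard = U.length := by
        rw [← Set.image_univ, Set.ncard_image_of_injective _ hinj,
          Set.ncard_univ, Nat.card_eq_fintype_card, Fintype.card_fin]
      rw [← h1, ← h2, hr]
      exact Set.ncard_insert_le _ _
    have hcard : (N \ Set.range e').ncard < N.ncard := by
      refine Set.ncard_lt_ncard ⟨Set.sdiff_subset, fun h => (h haN).2 ?_⟩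
      rw [hr]
      exact Set.mem_insert _ _
    obtain ⟨W, w, g, h1, h2⟩ := ih _ (by omega) he' Set.disjoint_sdiff_left
      (fun k c hc => hlow _ (hr ▸ ⟨k, rfl⟩) c (hun ▸ hc)) (hun ▸ htgt) rfl
    exact ⟨W, .up i w, g, ⟨e', he', rfl, hnew', fun k hk => hnew k hk ▸ ha, h1⟩, h2⟩
  -- The condition `e k ∉ P.tgt` matters only when all events have been started.
  by_cases hB : ∃ k, e k ∉ P.tgt ∧ ∀ b ∈ N, P.lt (e k) b
  · obtain ⟨k, hk, hkb⟩ := hB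
    obtain ⟨V, i, hi⟩ := Incl.exists_range_eq ({k}ᶜ : Set (Fin U.length))
    have hik : ∀ l, l ∉ Set.range i.emb → l = k := by
      intro l hl
      rw [hi] at hl
      simpa using hl
    have hlen : V.length < U.length := by
      have := Fintype.card_lt_of_injective_of_notMem i.emb i.emb.injective (b := k)
        (by rw [hi]; simp)
      simpa using this
    have hsub : Set.range (e ∘ i.emb) ⊆ Set.range e := Set.range_comp_subset_range _ _
    obtain ⟨W, w, g, h1, h2⟩ := ih _ (by omega) (he.comp i) (hN.mono_right hsub)
      (fun l c hc => hmin _ c (Set.union_subset_union_right _ hsub hc)) (fun t ht => by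
        rcases htgt ht with h | ⟨l, rfl⟩
        · exact Or.inl h
        · by_cases hl : l ∈ Set.range i.emb
          · obtain ⟨m, rfl⟩ := hl
            exact Or.inr ⟨m, rfl⟩
          · rw [hik l hl] at ht
            exact (hk ht).elim) rfl
    exact ⟨W, .down i w, g, ⟨fun l hl => hik l hl ▸ hkb, h1⟩, h2⟩
  obtain ⟨b, en, hbe, hlt⟩ := P.interval
  push Not at hA hB
  have hNe : N = ∅ := by
    by_contra hne
    obtain ⟨y, hy⟩ := Set.nonempty_iff_ne_empty.2 hne
    obtain ⟨a, haS, ha⟩ := Set.exists_min_image (N ∪ Set.range e) en (Set.toFinite _)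
      ⟨y, Or.inl hy⟩
    rcases haS with haN | ⟨k, rfl⟩
    · obtain ⟨c, hc, hca⟩ := hA a haN
      have := (hlt _ _).1 hca
      linarith [ha c hc, hbe a]
    · have hall : ∀ z ∈ N, P.lt (e k) z := by
        intro z hz
        obtain ⟨c, hc, hcz⟩ := hA z hz
        have := (hlt _ _).1 hcz
        exact (hlt _ _).2 (by linarith [ha c hc])
      by_cases hk : e k ∈ P.tgt
      · exact P.tgt_max _ hk _ (hall y hy)
      · obtain ⟨z, hz, h⟩ := hB k hk
        exact h (hall z hz)
  subst hNe
  refine ⟨U, .nil U, e, ⟨rfl, rfl⟩, Set.Subset.antisymm ?_ (by simpa using htgt)⟩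
  rintro _ ⟨k, rfl⟩
  by_contra hk
  obtain ⟨z, hz, -⟩ := hB k hk
  exact hz

theorem exists_spells (P : Iposet α) : ∃ (U W : List α) (w : Word U W), P.Spells w := by
  have := P.finite
  have hconc : ∀ x ∈ P.src, ∀ y ∈ P.src, P.Conc x y := fun x hx y hy =>
    ⟨P.src_min y hy x, P.src_min x hx y⟩
  obtain ⟨U, e, he, hr⟩ := exists_lists (lab := P.label) (ev := P.cev) P.src (Set.toFinite _)
    (fun x _ h => P.ev_irrefl x h.2)
    (fun x hx y _ z hz h h' => ⟨hconc x hx z hz, P.ev_trans _ _ _ h.2 h'.2⟩)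
    (fun x hx y hy hne => P.cev_total (hconc x hx y hy) hne)
  obtain ⟨W, w, g, h1, h2⟩ := P.exists_trace he (disjoint_compl_range hr)
    (fun k c _ => P.src_min _ (hr ▸ ⟨k, rfl⟩) c)
    (by rw [compl_union_range hr]; exact Set.subset_univ _)
  exact ⟨U, W, w, e, g, he, hr, h2, h1⟩

/-! ### Paths and words -/

theorem discrete_lists {U V : List α} (S T : Set (Fin U.length)) (i : Incl V U) :
    Lists (discrete U S T).label (discrete U S T).cev V i.emb :=
  ⟨i.label_eq, fun _ _ h => ⟨⟨id, id⟩, i.emb.strictMono h⟩⟩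

theorem spells_nil (U : List α) : (discrete U Set.univ Set.univ).Spells (nil U) :=
  ⟨id, id, discrete_lists _ _ (Incl.refl U), Set.range_id, Set.range_id, Set.compl_univ, rfl⟩

theorem spells_up {U V : List α} (i : Incl V U) :
    (discrete U (Set.range i.emb) Set.univ).Spells (up i (nil U)) := by
  refine ⟨i.emb, id, discrete_lists _ _ i, rfl, Set.range_id, id, discrete_lists _ _ (Incl.refl U),
    rfl, fun k hk => hk, fun _ _ _ _ h => h, ?_, rfl⟩
  exact Set.eq_empty_of_forall_notMem fun x hx => hx.2 ⟨x, rfl⟩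

theorem spells_down {U V : List α} (i : Incl V U) :
    (discrete U Set.univ (Set.range i.emb)).Spells (down i (nil V)) :=
  ⟨id, i.emb, discrete_lists _ _ (Incl.refl U), Set.range_id, rfl,
    fun _ _ _ hb => (hb trivial).elim, Set.compl_univ, rfl⟩

theorem exists_spells_word {U W : List α} (w : Word U W) : ∃ P : Iposet α, P.Spells w := by
  induction w with
  | nil U => exact ⟨_, spells_nil U⟩
  | up i w ih =>
    obtain ⟨P, hP⟩ := ih
    exact ⟨_, (spells_up i).glue (nonempty_match_of_spells (spells_up i) hP).some hP⟩
  | down i w ih =>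
    obtain ⟨P, hP⟩ := ih
    exact ⟨_, (spells_down i).glue (nonempty_match_of_spells (spells_down i) hP).some hP⟩

end Iposet

namespace HDA

variable {α : Type u} {X : HDA.{u, v} α}

theorem Path.exists_along {U V : List α} {x : X.cell U} {y : X.cell V} (p : X.Path x y) :
    ∃ w : Word U V, X.Along w x y ∧ p.ev.Spells w := by
  induction p with
  | nil x => exact ⟨.nil _, rfl, Iposet.spells_nil _⟩
  | cons s p ih =>
    obtain ⟨w, h1, h2⟩ := ih
    cases s with
    | up i x y h => exact ⟨.up i w, ⟨_, h, h1⟩, (Iposet.spells_up i).glue _ h2⟩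
    | down i x y h =>
      subst h
      exact ⟨.down i w, h1, (Iposet.spells_down i).glue _ h2⟩

theorem Along.exists_path {U V : List α} {w : Word U V} {x : X.cell U} {y : X.cell V}
    (h : X.Along w x y) : ∃ p : X.Path x y, p.ev.Spells w := by
  induction w with
  | nil U =>
    obtain rfl := h
    exact ⟨.nil x, Iposet.spells_nil U⟩
  | up i w ih =>
    obtain ⟨z, hz, h⟩ := h
    obtain ⟨p, hp⟩ := ih h
    exact ⟨.cons (.up i x z hz) p, (Iposet.spells_up i).glue _ hp⟩
  | down i w ih =>
    obtain ⟨p, hp⟩ := ih h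
    exact ⟨.cons (.down i x _ rfl) p, (Iposet.spells_down i).glue _ hp⟩

end HDA

/-! ### Paths along words that perform more events in sequence -/

namespace HDA

variable {α : Type u} {X : HDA.{u, v} α} {E : Type*} {lab : E → α} {ev lt : E → E → Prop}

/-- If `x` has a path to `y`, and the events of `B` are not preceded by any remaining event, then
they can be started first. -/
theorem Along.exists_start (hev : ∀ x y, ev x y → ¬ ev y x) {U W : List α} {q : Word U W}
    {x : X.cell U} {y : X.cell W} {N : Set E} {e : Fin U.length → E} {g : Fin W.length → E}
    (hq : X.Along q x y) (he : Lists lab ev U e)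
    (ht : q.Trace lab ev lt (fun _ _ => False) N e g) {B : Set E} (hBN : B ⊆ N)
    (hB : ∀ b ∈ B, ∀ c ∈ N ∪ Set.range e, ¬ lt c b) :
    ∃ (V : List α) (i : Incl U V) (e' : Fin V.length → E) (z : X.cell V) (q' : Word V W),
      Lists lab ev V e' ∧ e' ∘ i.emb = e ∧ Set.range e' = Set.range e ∪ B ∧
      X.face false i z = x ∧ X.Along q' z y ∧
      q'.Trace lab ev lt (fun _ _ => False) (N \ B) e' g := by
  induction q generalizing N B with
  | nil U =>
    obtain ⟨rfl, rfl⟩ := ht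
    obtain rfl := Set.subset_empty_iff.1 hBN
    exact ⟨U, Incl.refl U, g, x, nil U, he, rfl, by simp, X.face_refl _ _, hq, by simp, rfl⟩
  | @up U V W j q ih =>
    obtain ⟨d, d1, rfl, d3, -, d5⟩ := ht
    obtain ⟨t, ht, hq⟩ := hq
    have hun := diff_union_range d3
    obtain ⟨V', i', d', z, q', c1, rfl, c3, rfl, c5, c6⟩ := ih (B := B \ Set.range d) hq d1 d5
      (fun b hb => ⟨hBN hb.1, hb.2⟩) (fun b hb c hc => hB b hb.1 c (hun ▸ hc))
    have cinj := c1.injective hev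
    -- `k` omits the events that `q` starts first and that do not belong to `B`.
    obtain ⟨V₀, k, hk⟩ := Incl.exists_range_eq {l : Fin V'.length |
      d' l ∈ Set.range ((d' ∘ i'.emb) ∘ j.emb) ∪ B}
    obtain ⟨i, hi⟩ := Incl.exists_factor (j.trans i') k (by
      rintro _ ⟨l, rfl⟩
      rw [hk]
      exact Or.inl ⟨l, rfl⟩)
    have hi' : ∀ l, k.emb (i.emb l) = i'.emb (j.emb l) := fun l => Incl.emb_eq_of_eq hi l
    have hrange : Set.range (d' ∘ k.emb) = Set.range ((d' ∘ i'.emb) ∘ j.emb) ∪ B := by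
      apply Set.Subset.antisymm
      · rintro _ ⟨l, rfl⟩
        have : k.emb l ∈ Set.range k.emb := ⟨l, rfl⟩
        rw [hk] at this
        exact this
      · intro b hb
        have : b ∈ Set.range d' := by
          rw [c3]
          rcases hb with ⟨l, rfl⟩ | hb
          · exact Or.inl ⟨_, rfl⟩
          · by_cases h : b ∈ Set.range (d' ∘ i'.emb)
            · exact Or.inl h
            · exact Or.inr ⟨hb, h⟩
        obtain ⟨l, rfl⟩ := this
        have : l ∈ Set.range k.emb := by
          rw [hk]
          exact hb
        obtain ⟨m, rfl⟩ := this
        exact ⟨m, rfl⟩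
    refine ⟨V₀, i, d' ∘ k.emb, X.face false k z, up k q', c1.comp k, ?_, hrange, ?_,
      ⟨z, rfl, c5⟩, d', c1, rfl, ?_, fun _ _ _ _ h => h, ?_⟩
    · funext l
      exact congrArg d' (hi' l)
    · rw [X.face_trans, hi, ← X.face_trans, ht]
    · intro l hl
      rw [hk] at hl
      have h1 : d' l ∈ Set.range d' := ⟨l, rfl⟩
      rw [c3] at h1
      refine ⟨?_, fun h => hl (Or.inr h)⟩
      rcases h1 with ⟨m, hm⟩ | h1
      · obtain rfl := cinj hm
        refine d3 m ?_
        rintro ⟨n, rfl⟩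
        exact hl (Or.inl ⟨n, rfl⟩)
      · exact hBN h1.1
    · have : (N \ B) \ Set.range d' = (N \ Set.range (d' ∘ i'.emb)) \
          (B \ Set.range (d' ∘ i'.emb)) := by
        rw [c3]
        ext b
        simp only [Set.mem_sdiff, Set.mem_union]
        tauto
      rw [this]
      exact c6
  | @down U V W j q ih =>
    rcases B.eq_empty_or_nonempty with rfl | ⟨b, hb⟩
    · exact ⟨U, Incl.refl U, e, x, down j q, he, rfl, by simp, X.face_refl _ _, hq,
        by simpa using ht⟩
    · -- An event terminated now would precede `b`.
      have hs : Function.Surjective j.emb := by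
        intro k
        by_contra hk
        exact hB b hb _ (Or.inr ⟨k, rfl⟩) (ht.1 k hk b (hBN hb))
      obtain ⟨rfl, h⟩ := Sigma.mk.inj_iff.1 (j.eq_refl_of_surjective hs)
      obtain rfl := eq_of_heq h
      have hq' : X.Along q x y := by
        have := hq
        rwa [Along, X.face_refl] at this
      exact ih hq' he ht.2 hBN hB

/-- If `x` has a path to `y`, then active events that do not remain active until the end can be
terminated first. -/
theorem Along.exists_terminate (hev : ∀ x y, ev x y → ¬ ev y x) {U V W : List α} {q : Word U W}
    {x : X.cell U} {y : X.cell W} {N : Set E} {e : Fin U.length → E} {g : Fin W.length → E}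
    (hq : X.Along q x y) (he : Lists lab ev U e) (hN : Disjoint N (Set.range e))
    (ht : q.Trace lab ev lt (fun _ _ => False) N e g)
    (j : Incl V U) (hj : ∀ k, k ∉ Set.range j.emb → e k ∉ Set.range g) :
    ∃ q' : Word V W, X.Along q' (X.face true j x) y ∧
      q'.Trace lab ev lt (fun _ _ => False) N (e ∘ j.emb) g := by
  induction q generalizing N V with
  | nil U =>
    obtain ⟨rfl, rfl⟩ := ht
    have hs : Function.Surjective j.emb := fun k => by
      by_contra hk
      exact hj k hk ⟨k, rfl⟩
    obtain ⟨rfl, h⟩ := Sigma.mk.inj_iff.1 (j.eq_refl_of_surjective hs)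
    obtain rfl := eq_of_heq h
    refine ⟨nil _, ?_, rfl, rfl⟩
    rw [X.face_refl]
    exact hq
  | @up U U' W i q ih =>
    obtain ⟨d, d1, rfl, d3, -, d5⟩ := ht
    obtain ⟨t, rfl, hq⟩ := hq
    have dinj := d1.injective hev
    obtain ⟨V', k, hk⟩ := Incl.exists_range_eq
      (Set.range (j.trans i).emb ∪ (Set.range i.emb)ᶜ)
    obtain ⟨m, hm⟩ := Incl.exists_factor (j.trans i) k (by
      rw [hk]
      exact Set.subset_union_left)
    have hm' : ∀ l, k.emb (m.emb l) = i.emb (j.emb l) := fun l => Incl.emb_eq_of_eq hm l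
    -- The elements outside `k` are those of `U` outside `j`.
    have hk' : ∀ l, l ∉ Set.range k.emb → ∃ a, a ∉ Set.range j.emb ∧ i.emb a = l := by
      intro l hl
      rw [hk] at hl
      have h1 : l ∈ Set.range i.emb := by
        by_contra h
        exact hl (Or.inr h)
      obtain ⟨a, rfl⟩ := h1
      refine ⟨a, ?_, rfl⟩
      rintro ⟨b, rfl⟩
      exact hl (Or.inl ⟨b, rfl⟩)
    obtain ⟨q', h1, h2⟩ := ih hq d1 Set.disjoint_sdiff_left d5 k (by
      intro l hl
      obtain ⟨a, ha, rfl⟩ := hk' l hl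
      exact hj a ha)
    refine ⟨up m q', ⟨X.face true k t, ?_, h1⟩, d ∘ k.emb, d1.comp k, ?_, ?_,
      fun _ _ _ _ h => h, ?_⟩
    · refine (X.face_comm true false k i m j hm ?_ ?_ t)
      · rw [hk, Set.union_assoc, Set.union_comm _ (Set.range i.emb), Set.union_compl_self,
          Set.union_univ]
      · rw [hm, hk, Set.union_inter_distrib_right, Set.compl_inter_self, Set.union_empty,
          Set.inter_eq_left.2]
        rintro _ ⟨l, rfl⟩
        exact ⟨_, rfl⟩
    · funext l
      exact congrArg d (hm' l)
    · intro l hl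
      refine d3 _ ?_
      rintro ⟨a, ha⟩
      have : k.emb l ∈ Set.range k.emb := ⟨l, rfl⟩
      rw [hk] at this
      rcases this with ⟨b, hb⟩ | h
      · exact hl ⟨b, k.emb.injective ((hm' b).trans hb)⟩
      · exact h ⟨a, ha⟩
    · have : N \ Set.range (d ∘ k.emb) = N \ Set.range d := by
        ext b
        refine ⟨fun hb => ⟨hb.1, ?_⟩, fun hb => ⟨hb.1, ?_⟩⟩
        · rintro ⟨l, rfl⟩
          by_cases hl : l ∈ Set.range k.emb
          · obtain ⟨l, rfl⟩ := hl
            exact hb.2 ⟨l, rfl⟩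
          · obtain ⟨a, -, rfl⟩ := hk' l hl
            exact hN.ne_of_mem hb.1 ⟨a, rfl⟩ rfl
        · rintro ⟨l, rfl⟩
          exact hb.2 ⟨_, rfl⟩
      rw [this]
      exact h2
  | @down U U' W i q ih =>
    obtain ⟨Z, c, hc⟩ := Incl.exists_range_eq (Set.range i.emb ∩ Set.range j.emb)
    obtain ⟨a, ha⟩ := Incl.exists_factor c i (by rw [hc]; exact Set.inter_subset_left)
    obtain ⟨b, hb⟩ := Incl.exists_factor c j (by rw [hc]; exact Set.inter_subset_right)
    have ha' : ∀ l, i.emb (a.emb l) = c.emb l := fun l => Incl.emb_eq_of_eq ha l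
    have hb' : ∀ l, j.emb (b.emb l) = c.emb l := fun l => Incl.emb_eq_of_eq hb l
    obtain ⟨q', h1, h2⟩ := ih hq (he.comp i)
      (hN.mono_right (Set.range_comp_subset_range _ _)) ht.2 a (by
        intro l hl
        refine hj _ ?_
        rintro ⟨m, hm⟩
        have : i.emb l ∈ Set.range c.emb := by
          rw [hc]
          exact ⟨⟨l, rfl⟩, ⟨m, hm⟩⟩
        obtain ⟨n, hn⟩ := this
        exact hl ⟨n, i.emb.injective ((ha' n).trans hn)⟩)
    refine ⟨down b q', ?_, ?_, ?_⟩
    · change X.Along q' (X.face true b (X.face true j x)) y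
      rw [X.face_trans, hb, ← ha, ← X.face_trans]
      exact h1
    · intro l hl n hn
      refine ht.1 _ ?_ n hn
      rintro ⟨m, hm⟩
      have : j.emb l ∈ Set.range c.emb := by
        rw [hc]
        exact ⟨⟨m, hm⟩, ⟨l, rfl⟩⟩
      obtain ⟨n, hn⟩ := this
      exact hl ⟨n, j.emb.injective ((hb' n).trans hn)⟩
    · have : (e ∘ j.emb) ∘ b.emb = (e ∘ i.emb) ∘ a.emb := by
        funext l
        simp only [Function.comp, ha', hb']
      rw [this]
      exact h2

/-- A path that starts no event and terminates none does not move. -/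
theorem Along.eq_of_trace {U W : List α} {q : Word U W} {lt₂ : E → E → Prop}
    {x : X.cell U} {y : X.cell W} {e : Fin U.length → E} {g : Fin W.length → E}
    (hev : ∀ x y, ev x y → ¬ ev y x)
    (hq : X.Along q x y) (he : Lists lab ev U e) (ht : q.Trace lab ev lt lt₂ ∅ e g)
    (hr : Set.range e ⊆ Set.range g) :
    (⟨U, x⟩ : Σ U, X.cell U) = ⟨W, y⟩ := by
  induction q with
  | nil U =>
    obtain rfl := hq
    rfl
  | up i q ih =>
    obtain ⟨d, d1, rfl, d3, -, d5⟩ := ht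
    obtain ⟨t, rfl, hq⟩ := hq
    have hs : Function.Surjective i.emb := fun k => by
      by_contra hk
      exact d3 k hk
    obtain ⟨rfl, h⟩ := Sigma.mk.inj_iff.1 (i.eq_refl_of_surjective hs)
    obtain rfl := eq_of_heq h
    rw [Set.empty_sdiff] at d5
    rw [X.face_refl]
    exact ih hq d1 d5 hr
  | down i q ih =>
    have hs : Function.Surjective i.emb := fun k => by
      by_contra hk
      exact ht.terminated_notMem (he.injective hev) (Set.empty_disjoint _) hk (hr ⟨k, rfl⟩)
    obtain ⟨rfl, h⟩ := Sigma.mk.inj_iff.1 (i.eq_refl_of_surjective hs)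
    obtain rfl := eq_of_heq h
    have hq' : X.Along q x y := by
      have := hq
      rwa [Along, X.face_refl] at this
    exact ih hq' he ht.2 hr

/-- If the events can be performed in the order of `p` and if `lt` contains the order in which a
path along `q` performs them, then the path can be deformed into one along `p`. -/
theorem Along.of_trace (hev : ∀ x y, ev x y → ¬ ev y x) {U W : List α} {p q : Word U W}
    {x : X.cell U} {y : X.cell W} {N : Set E} {e : Fin U.length → E} {g : Fin W.length → E}
    (hq : X.Along q x y) (he : Lists lab ev U e) (hN : Disjoint N (Set.range e))
    (ht : q.Trace lab ev lt (fun _ _ => False) N e g)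
    (hp : p.Trace lab ev (fun _ _ => True) lt N e g) : X.Along p x y := by
  induction p generalizing N with
  | nil U =>
    obtain ⟨rfl, rfl⟩ := hp
    exact eq_of_heq (Sigma.mk.inj_iff.1 (hq.eq_of_trace hev he ht le_rfl)).2
  | @up U V W i p ih =>
    obtain ⟨d, d1, rfl, d3, d4, d5⟩ := hp
    obtain ⟨V', j, d', z, q', h1, h2, h3, h4, h5, h6⟩ := hq.exists_start hev he ht
      (B := N ∩ Set.range d) Set.inter_subset_left (by
        rintro b ⟨hb, ⟨k, rfl⟩⟩
        refine d4 k ?_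
        rintro ⟨l, rfl⟩
        exact hN.ne_of_mem hb ⟨l, rfl⟩ rfl)
    have hr : Set.range d' = Set.range d := by
      rw [h3]
      apply Set.Subset.antisymm
      · exact Set.union_subset (Set.range_comp_subset_range _ _) Set.inter_subset_right
      · rintro _ ⟨k, rfl⟩
        by_cases hk : k ∈ Set.range i.emb
        · obtain ⟨l, rfl⟩ := hk
          exact Or.inl ⟨l, rfl⟩
        · exact Or.inr ⟨d3 k hk, ⟨k, rfl⟩⟩
    obtain ⟨rfl, h⟩ := Sigma.mk.inj_iff.1 (d1.ext hev h1 hr)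
    obtain rfl := eq_of_heq h
    obtain rfl : j = i := Incl.ext_emb fun k => h1.injective hev (congrFun h2 k)
    rw [Set.sdiff_self_inter] at h6
    exact ⟨z, h4, ih h5 h1 Set.disjoint_sdiff_left h6 d5⟩
  | down i p ih =>
    obtain ⟨q', h1, h2⟩ := hq.exists_terminate hev he hN ht i fun k hk =>
      hp.terminated_notMem (he.injective hev) hN hk
    exact ih h1 (he.comp i) (hN.mono_right (Set.range_comp_subset_range _ _)) h2 hp.2

/-- If `P ⊑ Q`, every path that spells `Q` can be deformed into one that spells `P`, along any
word that spells `P`. -/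
theorem Along.of_subsumed {P Q : Iposet α} (h : P.Subsumed Q) {U W : List α} {p q : Word U W}
    {x : X.cell U} {y : X.cell W} (hq : X.Along q x y) (hQ : Q.Spells q) (hP : P.Spells p) :
    X.Along p x y := by
  obtain ⟨f, h1, h2, h3, h4, h5⟩ := h
  obtain ⟨e, g, e1, e2, e3, e4⟩ := hP
  obtain ⟨e', g', e1', e2', e3', e4'⟩ := hQ
  have hc := Iposet.cev_of_subsumption h4 h5
  have hlists : ∀ (V : List α) (d : Fin V.length → P.carrier) (d' : Fin V.length → Q.carrier),
      Lists P.label P.cev V d → Lists Q.label Q.cev V d' → f '' Set.range d = Set.range d' →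
      f ∘ d = d' := by
    intro V d d' hd hd' hr
    have hl : Lists Q.label Q.cev V (f ∘ d) := ⟨fun k => (h3 _).trans (hd.label_eq k),
      fun k l hkl => hc _ _ (hd.ev_of_lt k l hkl)⟩
    exact eq_of_heq (Sigma.mk.inj_iff.1 (hd'.ext Q.cev_asymm hl (by rw [Set.range_comp, hr]))).2
  have hfe : f ∘ e = e' := hlists U e e' e1 e1' (by rw [e2, e2', h1])
  have hfg : f ∘ g = g' := hlists W g g' (e4.lists e1) (e4'.lists e1') (by rw [e3, e3', h2])
  -- The precedence order of `P`, carried over to the events of `Q`.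
  let lt : Q.carrier → Q.carrier → Prop := fun x y => P.lt (f.symm x) (f.symm y)
  have ht := e4.append (lab' := Q.label) (ev' := Q.cev) (lt₁' := fun _ _ => True) (lt₂' := lt)
      (M := ∅) (w' := nil W) (h := f ∘ g) P.cev_asymm f f.injective h3 hc (fun _ _ _ => trivial)
      (fun x y h => by simpa [lt] using h) (fun _ h => h) (fun _ _ h => h.elim)
      (fun _ _ _ h => h.elim) e1 (Iposet.disjoint_compl_range e2) ⟨rfl, rfl⟩
  rw [append_nil, Set.union_empty, Iposet.image_compl_src h1, hfe, hfg] at ht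
  refine Along.of_trace Q.cev_asymm hq e1' (Iposet.disjoint_compl_range e2')
    (e4'.mono (fun x y h => ?_) fun _ _ h => h.elim) ht
  exact h4 _ _ (by simpa using h)

end HDA

/-! ### Languages in terms of words -/

namespace PomLang

variable {α : Type u} (L : PomLang α)

/-- The word `w` spells an element of `L`. -/
def HasWord {U W : List α} (w : Word U W) : Prop := ∃ P ∈ L.carrier, P.Spells w

variable {L}

theorem hasWord_iff {U W : List α} {w : Word U W} {P : Iposet α} (hP : P.Spells w) :
    L.HasWord w ↔ P ∈ L.carrier :=
  ⟨fun ⟨_, hQ, hw⟩ => L.down _ _ (hP.iso hw).subsumed hQ, fun h => ⟨P, h, hP⟩⟩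

theorem hasGlue_iff {U W V : List α} {p : Word U W} {q : Word W V} {P Q : Iposet α}
    (hP : P.Spells p) (hQ : Q.Spells q) : L.HasGlue P Q ↔ L.HasWord (p.append q) := by
  constructor
  · rintro ⟨f, hf⟩
    exact ⟨_, hf, hP.glue f hQ⟩
  · intro h
    obtain ⟨f⟩ := Iposet.nonempty_match_of_spells hP hQ
    exact ⟨f, (hasWord_iff (hP.glue f hQ)).1 h⟩

/-- Gluing is monotone in its first argument. -/
theorem HasGlue.of_subsumed {P Q R : Iposet α} (h : P.Subsumed Q) (hQ : L.HasGlue Q R) :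
    L.HasGlue P R := by
  obtain ⟨f, hf⟩ := hQ
  obtain ⟨U, W, p, hp⟩ := P.exists_spells
  obtain ⟨W', V, r, hr⟩ := R.exists_spells
  obtain rfl := Iposet.listing_eq_of_match f (h.admits hp) hr
  obtain ⟨f'⟩ := Iposet.nonempty_match_of_spells hp hr
  exact ⟨f', L.down _ _ ((hp.glue f' hr).subsumed ((h.admits hp).glue f hr.admits)) hf⟩

theorem swapInvariant_iff : L.SwapInvariant ↔ ∀ P Q : Iposet α, P.Subsumed Q →
    (L.prefixQuotient Q).Nonempty → L.prefixQuotient P = L.prefixQuotient Q := by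
  constructor
  · rintro h P Q hPQ ⟨R, hR⟩
    ext S
    exact ⟨fun hS => h P Q S R hS hR hPQ, fun hS => HasGlue.of_subsumed hPQ hS⟩
  · intro h P Q P' Q' hP hQ hPQ
    have : P' ∈ L.prefixQuotient Q := by
      rw [← h P Q hPQ ⟨Q', hQ⟩]
      exact hP
    exact this

end PomLang

/-! ### Deterministic automata have swap-invariant languages -/

namespace HDA

variable {α : Type u} {X : HDA.{u, v} α}

theorem mem_lang_iff {U W : List α} {w : Word U W} {P : Iposet α} (hP : P.Spells w) :
    P ∈ X.lang ↔ ∃ x ∈ X.start U, ∃ y ∈ X.accept W, X.Along w x y := by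
  constructor
  · rintro ⟨U', W', x, y, p, hx, hy, hi⟩
    obtain ⟨r, hr, hs⟩ := p.exists_along
    obtain ⟨rfl, rfl⟩ := hi.subsumed.listing_eq hP hs
    exact ⟨x, hx, y, hy, hr.of_subsumed hi.subsumed hs hP⟩
  · rintro ⟨x, hx, y, hy, h⟩
    obtain ⟨p, hp⟩ := h.exists_path
    exact ⟨U, W, x, y, p, hx, hy, hP.iso hp⟩

theorem accessible_iff {U : List α} {x : X.cell U} : X.Accessible x ↔
    ∃ (V : List α) (s : X.cell V) (w : Word V U), s ∈ X.start V ∧ X.Along w s x := by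
  constructor
  · rintro ⟨V, s, hs, ⟨p⟩⟩
    obtain ⟨w, hw, -⟩ := p.exists_along
    exact ⟨V, s, w, hs, hw⟩
  · rintro ⟨V, s, w, hs, h⟩
    obtain ⟨p, -⟩ := h.exists_path
    exact ⟨V, s, hs, ⟨p⟩⟩

theorem coaccessible_iff {U : List α} {x : X.cell U} : X.Coaccessible x ↔
    ∃ (V : List α) (t : X.cell V) (w : Word U V), t ∈ X.accept V ∧ X.Along w x t := by
  constructor
  · rintro ⟨V, t, ht, ⟨p⟩⟩
    obtain ⟨w, hw, -⟩ := p.exists_along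
    exact ⟨V, t, w, ht, hw⟩
  · rintro ⟨V, t, w, ht, h⟩
    obtain ⟨p, -⟩ := h.exists_path
    exact ⟨V, t, ht, ⟨p⟩⟩

theorem Accessible.along {U W : List α} {x : X.cell U} {y : X.cell W} (h : X.Accessible x)
    {w : Word U W} (hw : X.Along w x y) : X.Accessible y := by
  obtain ⟨V, s, p, hs, hp⟩ := accessible_iff.1 h
  exact accessible_iff.2 ⟨V, s, p.append w, hs, (along_append _ _ _ _).2 ⟨x, hp, hw⟩⟩

theorem Coaccessible.along {U W : List α} {x : X.cell U} {y : X.cell W} (h : X.Coaccessible y)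
    {w : Word U W} (hw : X.Along w x y) : X.Coaccessible x := by
  obtain ⟨V, t, p, ht, hp⟩ := coaccessible_iff.1 h
  exact coaccessible_iff.2 ⟨V, t, w.append p, ht, (along_append _ _ _ _).2 ⟨y, hw, hp⟩⟩

/-- Essential cells of a deterministic automaton are determined by a cell and a word that lead to
them. -/
theorem Deterministic.along_unique (hX : X.Deterministic) {U W : List α} {w : Word U W}
    {x : X.cell U} {y z : X.cell W} (hx : X.Accessible x) (hy : X.Coaccessible y)
    (hz : X.Coaccessible z) (hwy : X.Along w x y) (hwz : X.Along w x z) : y = z := by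
  induction w with
  | nil U => exact hwy.symm.trans hwz
  | @up U V W i w ih =>
    have hx' := hy.along hwy
    obtain ⟨a, ha, hay⟩ := hwy
    obtain ⟨b, hb, hbz⟩ := hwz
    have step : ∀ a : X.cell V, X.face false i a = x → X.Accessible a := fun a ha =>
      hx.along (w := .up i (.nil V)) ⟨a, ha, rfl⟩
    obtain rfl : a = b := hX.2 U V i x ⟨hx, hx'⟩ a b ⟨step a ha, hy.along hay⟩
      ⟨step b hb, hz.along hbz⟩ ha hb
    exact ih (step a ha) hy hz hay hbz
  | @down U V W i w ih =>
    exact ih (hx.along (w := .down i (.nil V)) rfl) hy hz hwy hwz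

theorem Deterministic.swapInvariant (hX : X.Deterministic) {L : PomLang α}
    (hL : X.lang = L.carrier) : L.SwapInvariant := by
  intro P Q P' Q' hP hQ h
  obtain ⟨f, -⟩ := id hP
  obtain ⟨f', -⟩ := id hQ
  obtain ⟨U, W, p, hp⟩ := P.exists_spells
  obtain ⟨U₁, W₁, q, hq⟩ := Q.exists_spells
  obtain ⟨W₂, V, p', hp'⟩ := P'.exists_spells
  obtain ⟨W₃, V', q', hq'⟩ := Q'.exists_spells
  obtain ⟨rfl, rfl⟩ := h.listing_eq hp hq
  obtain rfl := Iposet.listing_eq_of_match f hp hp'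
  obtain rfl := Iposet.listing_eq_of_match f' hq hq'
  have key : ∀ {U W : List α} (w : Word U W), L.HasWord w ↔
      ∃ x ∈ X.start U, ∃ y ∈ X.accept W, X.Along w x y := by
    intro U W w
    obtain ⟨R, hR⟩ := Iposet.exists_spells_word w
    rw [← mem_lang_iff hR, PomLang.hasWord_iff hR, hL]
  rw [PomLang.hasGlue_iff hp hp', key] at hP
  rw [PomLang.hasGlue_iff hq hq', key] at hQ
  rw [PomLang.hasGlue_iff hq hp', key]
  obtain ⟨x, hx, y, hy, hxy⟩ := hP
  obtain ⟨x', hx', y', hy', hxy'⟩ := hQ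
  obtain rfl := hX.1 U x hx x' hx'
  obtain ⟨z, hxz, hzy⟩ := (along_append _ _ _ _).1 hxy
  obtain ⟨z', hxz', hzy'⟩ := (along_append _ _ _ _).1 hxy'
  -- The path that spells `Q` leads to the same cell as the one that spells `P`.
  obtain rfl : z = z' := hX.along_unique
    (accessible_iff.2 ⟨U, x, .nil U, hx, rfl⟩) (coaccessible_iff.2 ⟨V, y, p', hy, hzy⟩)
    (coaccessible_iff.2 ⟨V', y', q', hy', hzy'⟩) hxz (hxz'.of_subsumed h hq hp)
  exact ⟨x, hx, y, hy, (along_append _ _ _ _).2 ⟨z, hxz', hzy⟩⟩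

end HDA

/-! ### Rewriting words -/

namespace Word

variable {α : Type u}

/-- Whenever the events of some iposet can be performed along `w'`, they can also be performed
along `w`, which may put more of them in sequence: the gluing of the steps of `w` is subsumed by
that of `w'`. -/
def Refines {U W : List α} (w w' : Word U W) : Prop :=
  ∀ (E : Type) (lab : E → α) (ev lt₁ lt₂ : E → E → Prop) (N : Set E) (e : Fin U.length → E)
    (g : Fin W.length → E), (∀ x y, ev x y → ¬ ev y x) → Lists lab ev U e →
    Disjoint N (Set.range e) → w'.Trace lab ev lt₁ lt₂ N e g →
    w.Trace lab ev (fun _ _ => True) lt₂ N e g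

theorem Refines.up {U V W : List α} {w w' : Word V W} (h : w.Refines w') (i : Incl U V) :
    (up i w).Refines (up i w') := by
  rintro E lab ev lt₁ lt₂ N e g hev - - ⟨d, h1, h2, h3, h4, h5⟩
  exact ⟨d, h1, h2, h3, h4, h _ _ _ _ _ _ _ _ hev h1 Set.disjoint_sdiff_left h5⟩

theorem Refines.down {U V W : List α} {w w' : Word V W} (h : w.Refines w') (i : Incl V U) :
    (down i w).Refines (down i w') := by
  rintro E lab ev lt₁ lt₂ N e g hev he hN ⟨-, h2⟩
  exact ⟨fun _ _ _ _ => trivial, h _ _ _ _ _ _ _ _ hev (he.comp i)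
    (hN.mono_right (Set.range_comp_subset_range _ _)) h2⟩

theorem Refines.append_left {U V W : List α} (p : Word U V) {w w' : Word V W} (h : w.Refines w') :
    (p.append w).Refines (p.append w') := by
  induction p with
  | nil => exact h
  | up i p ih => exact (ih h).up i
  | down i p ih => exact (ih h).down i

theorem Refines.admits {U W : List α} {w w' : Word U W} (h : w.Refines w') {P : Iposet α}
    (hP : P.Spells w') : P.Admits w := by
  obtain ⟨e, g, h1, h2, h3, h4⟩ := hP
  exact ⟨e, g, h1, h2, h3, h _ _ _ _ _ _ _ _ P.cev_asymm h1 (Iposet.disjoint_compl_range h2) h4⟩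

theorem up_up_refines {U V V' W : List α} (i : Incl U V) (j : Incl V V') (w : Word V' W) :
    (up i (up j w)).Refines (up (i.trans j) w) := by
  rintro E lab ev lt₁ lt₂ N e g hev - - ⟨d, h1, rfl, h3, h4, h5⟩
  have hnot : ∀ k, k ∉ Set.range i.emb → j.emb k ∉ Set.range (i.trans j).emb := by
    rintro k hk ⟨l, hl⟩
    exact hk ⟨l, j.emb.injective hl⟩
  have hnot' : ∀ k, k ∉ Set.range j.emb → k ∉ Set.range (i.trans j).emb := by
    rintro k hk ⟨l, hl⟩
    exact hk ⟨i.emb l, hl⟩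
  have hnew : ∀ k, k ∉ Set.range i.emb → (d ∘ j.emb) k ∈ N := fun k hk => h3 _ (hnot k hk)
  have hun := diff_union_range hnew
  refine ⟨d ∘ j.emb, h1.comp j, rfl, hnew, fun k hk => h4 _ (hnot k hk), d, h1, rfl,
    fun k hk => ⟨h3 k (hnot' k hk), ?_⟩, fun k hk c hc => h4 k (hnot' k hk) c (hun ▸ hc), ?_⟩
  · rintro ⟨l, hl⟩
    exact hk ⟨l, h1.injective hev hl⟩
  · rw [Set.sdiff_sdiff, Set.union_eq_right.2 (Set.range_comp_subset_range _ _)]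
    exact h5.mono (fun _ _ _ => trivial) fun _ _ h => h

theorem refines_up_up {U V V' W : List α} (i : Incl U V) (j : Incl V V') (w : Word V' W) :
    (up (i.trans j) w).Refines (up i (up j w)) := by
  rintro E lab ev lt₁ lt₂ N e g - - hN ⟨c, c1, rfl, c3, c4, d, h1, rfl, h3, h4, h5⟩
  have hun := diff_union_range c3
  have hcase : ∀ k, k ∉ Set.range (i.trans j).emb → k ∉ Set.range j.emb ∨
      ∃ l, l ∉ Set.range i.emb ∧ j.emb l = k := by
    intro k hk
    by_cases h : k ∈ Set.range j.emb
    · obtain ⟨l, rfl⟩ := h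
      refine Or.inr ⟨l, ?_, rfl⟩
      rintro ⟨m, rfl⟩
      exact hk ⟨m, rfl⟩
    · exact Or.inl h
  refine ⟨d, h1, rfl, ?_, ?_, ?_⟩
  · intro k hk
    rcases hcase k hk with h | ⟨l, hl, rfl⟩
    · exact (h3 k h).1
    · exact c3 l hl
  · intro k hk
    rcases hcase k hk with h | ⟨l, hl, rfl⟩
    · exact hun ▸ h4 k h
    · exact c4 l hl
  · rw [Set.sdiff_sdiff, Set.union_eq_right.2 (Set.range_comp_subset_range _ _)] at h5
    exact h5.mono (fun _ _ _ => trivial) fun _ _ h => h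

theorem down_down_refines {U V V' W : List α} (i : Incl V U) (j : Incl V' V) (w : Word V' W) :
    (down i (down j w)).Refines (down (j.trans i) w) := by
  rintro E lab ev lt₁ lt₂ N e g - - - ⟨-, h⟩
  exact ⟨fun _ _ _ _ => trivial, fun _ _ _ _ => trivial,
    h.mono (fun _ _ _ => trivial) fun _ _ h => h⟩

theorem refines_down_down {U V V' W : List α} (i : Incl V U) (j : Incl V' V) (w : Word V' W) :
    (down (j.trans i) w).Refines (down i (down j w)) := by
  rintro E lab ev lt₁ lt₂ N e g - - - ⟨-, -, h⟩
  exact ⟨fun _ _ _ _ => trivial, h.mono (fun _ _ _ => trivial) fun _ _ h => h⟩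

theorem up_refl_refines {U W : List α} (w : Word U W) : (up (Incl.refl U) w).Refines w := by
  rintro E lab ev lt₁ lt₂ N e g - he hN h
  refine ⟨e, he, rfl, fun k hk => (hk ⟨k, rfl⟩).elim, fun k hk => (hk ⟨k, rfl⟩).elim, ?_⟩
  rw [hN.sdiff_eq_left]
  exact h.mono (fun _ _ _ => trivial) fun _ _ h => h

theorem refines_up_refl {U W : List α} (w : Word U W) : w.Refines (up (Incl.refl U) w) := by
  rintro E lab ev lt₁ lt₂ N e g - - hN ⟨d, -, rfl, -, -, h⟩
  have hd : N \ Set.range d = N := Disjoint.sdiff_eq_left hN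
  rw [hd] at h
  exact h.mono (fun _ _ _ => trivial) fun _ _ h => h

theorem down_refl_refines {U W : List α} (w : Word U W) : (down (Incl.refl U) w).Refines w := by
  rintro E lab ev lt₁ lt₂ N e g - - - h
  exact ⟨fun _ _ _ _ => trivial, h.mono (fun _ _ _ => trivial) fun _ _ h => h⟩

theorem refines_down_refl {U W : List α} (w : Word U W) : w.Refines (down (Incl.refl U) w) := by
  rintro E lab ev lt₁ lt₂ N e g - - - ⟨-, h⟩
  exact h.mono (fun _ _ _ => trivial) fun _ _ h => h

/-- Terminating events before starting others puts them in sequence. -/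
theorem down_up_refines {Z V V' U W : List α} (j' : Incl Z V) (i : Incl Z V') (i' : Incl V U)
    (j : Incl V' U) (h : j'.trans i' = i.trans j)
    (hunion : Set.range i'.emb ∪ Set.range j.emb = Set.univ)
    (hinter : Set.range (j'.trans i').emb = Set.range i'.emb ∩ Set.range j.emb) (w : Word V' W) :
    (down j' (up i w)).Refines (up i' (down j w)) := by
  rintro E lab ev lt₁ lt₂ N e g - - hN ⟨d, h1, rfl, h3, h4, -, h5⟩
  have hnot : ∀ k, k ∉ Set.range i.emb → j.emb k ∉ Set.range i'.emb := by
    intro k hk hk'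
    have : j.emb k ∈ Set.range (j'.trans i').emb := by
      rw [hinter]
      exact ⟨hk', ⟨k, rfl⟩⟩
    obtain ⟨l, hl⟩ := this
    rw [h] at hl
    exact hk ⟨l, j.emb.injective hl⟩
  refine ⟨fun _ _ _ _ => trivial, d ∘ j.emb, h1.comp j, ?_, fun k hk => h3 _ (hnot k hk),
    fun k hk c hc => h4 _ (hnot k hk) c ?_, ?_⟩
  · funext k
    exact congrArg d (Incl.emb_eq_of_eq h k).symm
  · exact Set.union_subset_union_right _ (Set.range_comp_subset_range _ _) hc
  · have : N \ Set.range (d ∘ j.emb) = N \ Set.range d := by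
      ext x
      refine ⟨fun hx => ⟨hx.1, ?_⟩, fun hx => ⟨hx.1, ?_⟩⟩
      · rintro ⟨k, rfl⟩
        have : k ∈ Set.range i'.emb ∪ Set.range j.emb := hunion ▸ trivial
        rcases this with ⟨l, rfl⟩ | ⟨l, rfl⟩
        · exact hN.ne_of_mem hx.1 ⟨l, rfl⟩ rfl
        · exact hx.2 ⟨l, rfl⟩
      · rintro ⟨k, rfl⟩
        exact hx.2 ⟨_, rfl⟩
    rw [this]
    exact h5.mono (fun _ _ _ => trivial) fun _ _ h => h

end Word

namespace PomLang

variable {α : Type u} {L : PomLang α}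

theorem HasWord.of_refines {U W : List α} {w w' : Word U W} (h : w.Refines w')
    (hw : L.HasWord w') : L.HasWord w := by
  obtain ⟨P, hP, hw⟩ := hw
  obtain ⟨Q, hQ⟩ := Iposet.exists_spells_word w
  exact ⟨Q, L.down _ _ (hQ.subsumed (h.admits hw)) hP, hQ⟩

theorem SwapInvariant.hasWord (hL : L.SwapInvariant) {U W V V' : List α} {p q : Word U W}
    {p' : Word W V} {q' : Word W V'} (h : p.Refines q) (hp : L.HasWord (p.append p'))
    (hq : L.HasWord (q.append q')) : L.HasWord (q.append p') := by
  obtain ⟨P, hP⟩ := Iposet.exists_spells_word p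
  obtain ⟨Q, hQ⟩ := Iposet.exists_spells_word q
  obtain ⟨P', hP'⟩ := Iposet.exists_spells_word p'
  obtain ⟨Q', hQ'⟩ := Iposet.exists_spells_word q'
  rw [← hasGlue_iff hP hP'] at hp
  rw [← hasGlue_iff hQ hQ'] at hq
  rw [← hasGlue_iff hQ hP']
  exact hL P Q P' Q' hp hq (hP.subsumed (h.admits hQ))

end PomLang

/-! ### Squares of inclusions -/

namespace Incl

variable {α : Type u}

/-- `k` is the inclusion of the loset `W ∪ (U - V)` into `U`, and `m` that of `W` into it. -/
structure IsAdjoin {W V U K : List α} (l : Incl V U) (j : Incl W V) (k : Incl K U) (m : Incl W K) :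
    Prop where
  comm : m.trans k = j.trans l
  range_eq : Set.range k.emb = Set.range (j.trans l).emb ∪ (Set.range l.emb)ᶜ

/-- `b` and `a` are the inclusions of the intersection `U ∩ W` of two parts of `V` into these. -/
structure IsMeet {U V W Z : List α} (i : Incl U V) (j : Incl W V) (b : Incl Z U) (a : Incl Z W) :
    Prop where
  comm : a.trans j = b.trans i
  range_eq : Set.range (b.trans i).emb = Set.range i.emb ∩ Set.range j.emb

theorem exists_isAdjoin {W V U : List α} (l : Incl V U) (j : Incl W V) :
    ∃ (K : List α) (k : Incl K U) (m : Incl W K), IsAdjoin l j k m := by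
  obtain ⟨K, k, hk⟩ := exists_range_eq (Set.range (j.trans l).emb ∪ (Set.range l.emb)ᶜ)
  obtain ⟨m, hm⟩ := exists_factor (j.trans l) k (by rw [hk]; exact Set.subset_union_left)
  exact ⟨K, k, m, hm, hk⟩

theorem exists_isMeet {U V W : List α} (i : Incl U V) (j : Incl W V) :
    ∃ (Z : List α) (b : Incl Z U) (a : Incl Z W), IsMeet i j b a := by
  obtain ⟨Z, c, hc⟩ := exists_range_eq (Set.range i.emb ∩ Set.range j.emb)
  obtain ⟨b, rfl⟩ := exists_factor c i (by rw [hc]; exact Set.inter_subset_left)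
  obtain ⟨a, ha⟩ := exists_factor (b.trans i) j (by rw [hc]; exact Set.inter_subset_right)
  exact ⟨Z, b, a, ha, hc⟩

/-- `K`, `k` and `m` are determined by `l` and `j`, so a property of one choice of them holds for
every other. -/
theorem IsAdjoin.elim {W V U K K' : List α} {l : Incl V U} {j : Incl W V} {k : Incl K U}
    {m : Incl W K} {k' : Incl K' U} {m' : Incl W K'} (h : IsAdjoin l j k m)
    (h' : IsAdjoin l j k' m') {motive : ∀ K, Incl K U → Incl W K → Prop} (hm : motive K k m) :
    motive K' k' m' := by
  obtain ⟨rfl, hk⟩ := Sigma.mk.inj_iff.1 (k.eq_of_range_eq k' (h.range_eq.trans h'.range_eq.symm))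
  obtain rfl := eq_of_heq hk
  obtain rfl := trans_cancel (h.comm.trans h'.comm.symm)
  exact hm

theorem IsMeet.elim {U V W Z Z' : List α} {i : Incl U V} {j : Incl W V} {b : Incl Z U}
    {a : Incl Z W} {b' : Incl Z' U} {a' : Incl Z' W} (h : IsMeet i j b a)
    (h' : IsMeet i j b' a') {motive : ∀ Z, Incl Z U → Incl Z W → Prop} (hm : motive Z b a) :
    motive Z' b' a' := by
  obtain ⟨rfl, hk⟩ := Sigma.mk.inj_iff.1
    ((b.trans i).eq_of_range_eq (b'.trans i) (h.range_eq.trans h'.range_eq.symm))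
  have hb := eq_of_heq hk
  obtain rfl := trans_cancel hb
  obtain rfl := trans_cancel (h.comm.trans h'.comm.symm)
  exact hm

theorem range_trans {W V U : List α} (j : Incl W V) (i : Incl V U) :
    Set.range (j.trans i).emb = i.emb '' Set.range j.emb := by
  rw [← Set.range_comp]
  rfl

theorem range_refl (U : List α) : Set.range (refl U).emb = Set.univ := Set.range_id

theorem range_trans_subset {W V U : List α} (j : Incl W V) (i : Incl V U) :
    Set.range (j.trans i).emb ⊆ Set.range i.emb := by
  rw [range_trans]
  exact Set.image_subset_range _ _

theorem range_trans_inter {W Z V U : List α} (j : Incl W V) (k : Incl Z V) (i : Incl V U) :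
    Set.range (j.trans i).emb ∩ Set.range (k.trans i).emb =
      i.emb '' (Set.range j.emb ∩ Set.range k.emb) := by
  rw [range_trans, range_trans, Set.image_inter i.emb.injective]

theorem isAdjoin_refl_left {W U : List α} (j : Incl W U) : IsAdjoin (refl U) j j (refl W) :=
  ⟨rfl, by rw [range_refl, Set.compl_univ, Set.union_empty, trans_refl]⟩

theorem isAdjoin_refl_right {V U : List α} (l : Incl V U) : IsAdjoin l (refl V) (refl U) l :=
  ⟨rfl, by rw [range_refl, refl_trans, Set.union_compl_self]⟩

/-- Adjoining the same events to a smaller loset. -/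
theorem IsAdjoin.restrict {W' W V U K K' : List α} {l : Incl V U} {j : Incl W V} {k : Incl K U}
    {m : Incl W K} (h : IsAdjoin l j k m) (i : Incl W' W) {k' : Incl K' U} {m' : Incl W' K'}
    (h' : IsAdjoin l (i.trans j) k' m') :
    ∃ i' : Incl K' K, i'.trans k = k' ∧ m'.trans i' = i.trans m ∧
      Set.range i'.emb ∪ Set.range m.emb = Set.univ ∧
      Set.range (m'.trans i').emb = Set.range i'.emb ∩ Set.range m.emb := by
  obtain ⟨i', rfl⟩ := exists_factor k' k (by
    rw [h'.range_eq, h.range_eq]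
    exact Set.union_subset_union_left _ (range_trans_subset i (j.trans l)))
  have hcomm : m'.trans i' = i.trans m := by
    apply trans_cancel (i := k)
    rw [trans_assoc, h'.comm]
    exact congrArg i.trans h.comm.symm
  have hk : ∀ x, k.emb x ∉ Set.range l.emb → x ∈ Set.range i'.emb := by
    intro x hx
    have : k.emb x ∈ Set.range (i'.trans k).emb := by
      rw [h'.range_eq]
      exact Or.inr hx
    obtain ⟨y, hy⟩ := this
    exact ⟨y, k.emb.injective hy⟩
  refine ⟨i', rfl, hcomm, ?_, ?_⟩
  · refine Set.eq_univ_of_forall fun x => ?_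
    have : k.emb x ∈ Set.range k.emb := ⟨x, rfl⟩
    rw [h.range_eq] at this
    rcases this with h1 | h1
    · rw [← h.comm] at h1
      obtain ⟨y, hy⟩ := h1
      exact Or.inr ⟨y, k.emb.injective hy⟩
    · exact Or.inl (hk x h1)
  · apply Set.Subset.antisymm
    · refine Set.subset_inter (range_trans_subset _ _) ?_
      rw [hcomm]
      exact range_trans_subset _ _
    · rintro _ ⟨⟨x, rfl⟩, ⟨y, hy⟩⟩
      have : k.emb (i'.emb x) ∈ Set.range (i'.trans k).emb := ⟨x, rfl⟩
      rw [h'.range_eq] at this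
      rcases this with h1 | h1
      · rw [← h'.comm] at h1
        obtain ⟨z, hz⟩ := h1
        exact ⟨z, k.emb.injective hz⟩
      · refine (h1 ?_).elim
        rw [← hy]
        exact ⟨j.emb y, (emb_eq_of_eq h.comm y).symm⟩

theorem IsAdjoin.trans {T W V U K K' : List α} {i : Incl V U} {j : Incl W V} {l : Incl T W}
    {k : Incl K V} {m : Incl T K} (h : IsAdjoin j l k m) {k' : Incl K' U} {m' : Incl K K'}
    (h' : IsAdjoin i k k' m') : IsAdjoin (j.trans i) l k' (m.trans m') := by
  refine ⟨?_, ?_⟩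
  · rw [trans_assoc, h'.comm, ← trans_assoc, h.comm]
    rfl
  · rw [h'.range_eq, range_trans k, h.range_eq, Set.image_union, ← range_trans,
      Set.image_compl_eq_range_sdiff_image i.emb.injective, ← range_trans, Set.union_assoc]
    congr 1
    ext x
    have : x ∈ Set.range (j.trans i).emb → x ∈ Set.range i.emb := fun h => range_trans_subset _ _ h
    simp only [Set.mem_union, Set.mem_sdiff, Set.mem_compl_iff]
    tauto

/-- Adjunctions are compatible with complementary inclusions. -/
theorem IsAdjoin.extend {T Z V W U K : List α} {i : Incl V U} {j : Incl W U} {j' : Incl Z V}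
    {i' : Incl Z W} (hcomm : j'.trans i = i'.trans j)
    (hunion : Set.range i.emb ∪ Set.range j.emb = Set.univ)
    (hinter : Set.range (j'.trans i).emb = Set.range i.emb ∩ Set.range j.emb)
    {l : Incl T Z} {k : Incl K V} {m : Incl T K} (h : IsAdjoin j' l k m) :
    IsAdjoin j (l.trans i') (k.trans i) m := by
  refine ⟨?_, ?_⟩
  · rw [← trans_assoc, h.comm, trans_assoc, hcomm]
    rfl
  · rw [range_trans k, h.range_eq, Set.image_union, ← range_trans,
      Set.image_compl_eq_range_sdiff_image i.emb.injective, ← range_trans, hinter, trans_assoc,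
      hcomm, trans_assoc]
    congr 1
    ext x
    have : x ∈ Set.range i.emb ∪ Set.range j.emb := hunion ▸ trivial
    simp only [Set.mem_union, Set.mem_sdiff, Set.mem_compl_iff, Set.mem_inter_iff] at this ⊢
    tauto

/-- Intersecting with a smaller loset. -/
theorem IsMeet.restrict {U V W W' Z Z' : List α} {i : Incl U V} {j : Incl W V} {b : Incl Z U}
    {a : Incl Z W} (h : IsMeet i j b a) (k : Incl W' W) {b' : Incl Z' U} {a' : Incl Z' W'}
    (h' : IsMeet i (k.trans j) b' a') : ∃ c : Incl Z' Z, c.trans b = b' ∧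
      c.trans a = a'.trans k := by
  have hsub : Set.range (b'.trans i).emb ⊆ Set.range (b.trans i).emb := by
    rw [h.range_eq, h'.range_eq]
    exact Set.inter_subset_inter_right _ (range_trans_subset _ _)
  obtain ⟨c, hc⟩ := exists_factor b' b (by
    rw [range_trans, range_trans] at hsub
    exact (Set.image_subset_image_iff i.emb.injective).1 hsub)
  refine ⟨c, hc, trans_cancel (i := j) ?_⟩
  rw [trans_assoc, h.comm, trans_assoc, h'.comm, ← hc]
  rfl

theorem isMeet_trans_self {U V W : List α} (i : Incl U V) (j : Incl W U) :
    IsMeet i (j.trans i) j (refl W) :=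
  ⟨rfl, (Set.inter_eq_right.2 (range_trans_subset _ _)).symm⟩

theorem isMeet_refl {U V : List α} (i : Incl U V) : IsMeet i (refl V) (refl U) i :=
  ⟨rfl, by rw [range_refl, Set.inter_univ, refl_trans]⟩

end Incl

/-! ### The universal deterministic automaton of a swap-invariant language -/

section Universal

variable {α : Type u}

/-- A cell of type `U` of the universal automaton of `L`. It stands for the situation after an
unspecified run with active events `U`, and records only what the automaton has to know. An
inclusion `i : V → U` stands for the modified run in which the events of `U` outside `V` have not
been started yet: `born V i` says that this makes sense (none of them was active from the very
beginning), and `res V W i w` that the modified run can be completed by the word `w` to an element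
of `L`. By convention, everything is a completion if `i` is not born. -/
@[ext]
structure ResidualCell (L : PomLang α) (U : List α) where
  born : ∀ V, Incl V U → Prop
  res : ∀ V W, Incl V U → Word V W → Prop
  /-- Several events can be removed if each of them can. -/
  born_inter : ∀ {Z V W : List α} (i : Incl V U) (j : Incl W U) (k : Incl Z U),
    Set.range k.emb = Set.range i.emb ∩ Set.range j.emb → (born Z k ↔ born V i ∧ born W j)
  /-- The convention for runs that do not make sense. -/
  res_of_not_born : ∀ {V W : List α} (i : Incl V U) (w : Word V W), ¬ born V i → res V W i w
  /-- The completions of a modified run form a residual of `L`. -/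
  exists_prefix : ∀ {V : List α} (i : Incl V U), born V i → ∃ (V₀ : List α) (p : Word V₀ V),
    ∀ (W : List α) (w : Word V W), res V W i w ↔ L.HasWord (p.append w)
  /-- Starting events later puts more events in sequence, so that the result stays in `L`. -/
  res_up : ∀ {Z V W : List α} (i : Incl Z V) (j : Incl V U) (w : Word V W),
    res V W j w → res Z W (i.trans j) (up i w)
  /-- Conversely, by swap-invariance, completions that start events later are completions of the
  original run, as soon as that run has a completion at all. -/
  res_of_up : ∀ {Z V W W' : List α} (i : Incl Z V) (j : Incl V U) (w : Word V W) (w' : Word V W'),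
    born Z (i.trans j) → res V W' j w' → res Z W (i.trans j) (up i w) → res V W j w

namespace ResidualCell

variable {L : PomLang α} {U : List α}

theorem born_of_trans (c : ResidualCell L U) {Z V : List α} (i : Incl Z V) (j : Incl V U)
    (h : c.born Z (i.trans j)) : c.born V j :=
  ((c.born_inter (i.trans j) j (i.trans j)
    (Set.inter_eq_left.2 (Incl.range_trans_subset i j)).symm).1 h).2

theorem res_of_refines (c : ResidualCell L U) {V W : List α} {i : Incl V U} {w w' : Word V W}
    (h : w.Refines w') (hw : c.res V W i w') : c.res V W i w := by
  by_cases hb : c.born V i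
  · obtain ⟨V₀, p, hp⟩ := c.exists_prefix i hb
    rw [hp] at hw ⊢
    exact hw.of_refines (h.append_left p)
  · exact c.res_of_not_born i w hb

theorem res_swap (hL : L.SwapInvariant) (c : ResidualCell L U) {V Z W W' : List α} {i : Incl V U}
    (hb : c.born V i) {p q : Word V Z} {w : Word Z W} {w' : Word Z W'} (h : p.Refines q)
    (hp : c.res V W i (p.append w)) (hq : c.res V W' i (q.append w')) :
    c.res V W i (q.append w) := by
  obtain ⟨V₀, r, hr⟩ := c.exists_prefix i hb
  rw [hr, ← append_assoc] at hp hq ⊢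
  exact hL.hasWord (h.append_left r) hp hq

/-- The lower face: the events outside `l` are not started yet. -/
def lowerFace {V : List α} (l : Incl V U) (c : ResidualCell L U) : ResidualCell L V where
  born W j := c.born W (j.trans l)
  res W Z j w := c.res W Z (j.trans l) w
  born_inter i j k h := c.born_inter _ _ _ (by
    rw [Incl.range_trans_inter, ← h, Incl.range_trans])
  res_of_not_born i w h := c.res_of_not_born _ w h
  exists_prefix i h := c.exists_prefix _ h
  res_up i j w h := c.res_up i (j.trans l) w h
  res_of_up i j w w' h := c.res_of_up i (j.trans l) w w' h

/-- The predicate `born` of the upper face along `l : V → U`. The events of `V` outside `W` are the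
events of `U` outside `W ∪ (U - V)`. -/
def upperBorn {V : List α} (l : Incl V U) (c : ResidualCell L U) (W : List α) (j : Incl W V) :
    Prop :=
  ∃ (K : List α) (k : Incl K U) (m : Incl W K), Incl.IsAdjoin l j k m ∧ c.born K k

/-- The predicate `res` of the upper face along `l : V → U`: the events of `U - V` are terminated
before `w` is performed. -/
def upperRes {V : List α} (l : Incl V U) (c : ResidualCell L U) (W Z : List α) (j : Incl W V)
    (w : Word W Z) : Prop :=
  ∃ (K : List α) (k : Incl K U) (m : Incl W K), Incl.IsAdjoin l j k m ∧ c.res K Z k (down m w)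

theorem upperBorn_iff {V W K : List α} {l : Incl V U} {c : ResidualCell L U} {j : Incl W V}
    {k : Incl K U} {m : Incl W K} (h : Incl.IsAdjoin l j k m) :
    c.upperBorn l W j ↔ c.born K k :=
  ⟨fun ⟨_, _, _, h', hb⟩ => h'.elim h (motive := fun K k _ => c.born K k) hb,
    fun hb => ⟨K, k, m, h, hb⟩⟩

theorem upperRes_iff {V W Z K : List α} {l : Incl V U} {c : ResidualCell L U} {j : Incl W V}
    {k : Incl K U} {m : Incl W K} (h : Incl.IsAdjoin l j k m) (w : Word W Z) :
    c.upperRes l W Z j w ↔ c.res K Z k (down m w) :=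
  ⟨fun ⟨_, _, _, h', hb⟩ => h'.elim h (motive := fun K k m => c.res K Z k (down m w)) hb,
    fun hb => ⟨K, k, m, h, hb⟩⟩

/-- The upper face: the events outside `l` are terminated. -/
def upperFace (hL : L.SwapInvariant) {V : List α} (l : Incl V U) (c : ResidualCell L U) :
    ResidualCell L V where
  born := c.upperBorn l
  res := c.upperRes l
  born_inter i j k h := by
    obtain ⟨_, ki, mi, hi⟩ := Incl.exists_isAdjoin l i
    obtain ⟨_, kj, mj, hj⟩ := Incl.exists_isAdjoin l j
    obtain ⟨_, kk, mk, hk⟩ := Incl.exists_isAdjoin l k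
    rw [upperBorn_iff hi, upperBorn_iff hj, upperBorn_iff hk]
    apply c.born_inter
    rw [hi.range_eq, hj.range_eq, hk.range_eq, ← Set.inter_union_distrib_right,
      Incl.range_trans_inter, ← h, Incl.range_trans]
  res_of_not_born i w h := by
    obtain ⟨_, k, m, hi⟩ := Incl.exists_isAdjoin l i
    rw [upperBorn_iff hi] at h
    rw [upperRes_iff hi]
    exact c.res_of_not_born _ _ h
  exists_prefix i h := by
    obtain ⟨_, k, m, hi⟩ := Incl.exists_isAdjoin l i
    rw [upperBorn_iff hi] at h
    obtain ⟨V₀, p, hp⟩ := c.exists_prefix k h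
    refine ⟨V₀, p.append (down m (nil _)), fun W w => ?_⟩
    rw [upperRes_iff hi, hp, append_assoc]
    rfl
  res_up i j w h := by
    obtain ⟨_, k, m, hj⟩ := Incl.exists_isAdjoin l j
    obtain ⟨_, k', m', hij⟩ := Incl.exists_isAdjoin l (i.trans j)
    rw [upperRes_iff hj] at h
    rw [upperRes_iff hij]
    obtain ⟨i', rfl, h1, h2, h3⟩ := hj.restrict i hij
    exact c.res_of_refines (down_up_refines m' i i' m h1 h2 h3 w) (c.res_up i' k _ h)
  res_of_up i j w w' hb h h' := by
    obtain ⟨_, k, m, hj⟩ := Incl.exists_isAdjoin l j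
    obtain ⟨_, k', m', hij⟩ := Incl.exists_isAdjoin l (i.trans j)
    rw [upperBorn_iff hij] at hb
    rw [upperRes_iff hj] at h ⊢
    rw [upperRes_iff hij] at h'
    obtain ⟨i', rfl, h1, h2, h3⟩ := hj.restrict i hij
    refine c.res_of_up i' k _ _ hb h ?_
    exact c.res_swap hL hb (p := down m' (up i (nil _))) (q := up i' (down m (nil _))) (w := w)
      (down_up_refines m' i i' m h1 h2 h3 _) h' (c.res_up i' k _ h)

/-- The predicate `born` of the cell reached by starting the events of `V - U`, which can all be
removed again. -/
def extendBorn {V : List α} (i : Incl U V) (c : ResidualCell L U) (W : List α) (j : Incl W V) :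
    Prop :=
  ∃ (Z : List α) (b : Incl Z U) (a : Incl Z W), Incl.IsMeet i j b a ∧ c.born Z b

/-- The predicate `res` of the cell reached by starting the events of `V - U`: if those outside `W`
are removed, then those of `W - U` are still to be started before `w` is performed. -/
def extendRes {V : List α} (i : Incl U V) (c : ResidualCell L U) (W T : List α) (j : Incl W V)
    (w : Word W T) : Prop :=
  ∃ (Z : List α) (b : Incl Z U) (a : Incl Z W), Incl.IsMeet i j b a ∧ c.res Z T b (up a w)

theorem extendBorn_iff {V W Z : List α} {i : Incl U V} {c : ResidualCell L U} {j : Incl W V}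
    {b : Incl Z U} {a : Incl Z W} (h : Incl.IsMeet i j b a) :
    c.extendBorn i W j ↔ c.born Z b :=
  ⟨fun ⟨_, _, _, h', hb⟩ => h'.elim h (motive := fun Z b _ => c.born Z b) hb,
    fun hb => ⟨Z, b, a, h, hb⟩⟩

theorem extendRes_iff {V W Z T : List α} {i : Incl U V} {c : ResidualCell L U} {j : Incl W V}
    {b : Incl Z U} {a : Incl Z W} (h : Incl.IsMeet i j b a) (w : Word W T) :
    c.extendRes i W T j w ↔ c.res Z T b (up a w) :=
  ⟨fun ⟨_, _, _, h', hb⟩ => h'.elim h (motive := fun Z b a => c.res Z T b (up a w)) hb,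
    fun hb => ⟨Z, b, a, h, hb⟩⟩

/-- The cell reached from `c` by starting the events of `V - U`. -/
def extend {V : List α} (i : Incl U V) (c : ResidualCell L U) : ResidualCell L V where
  born := c.extendBorn i
  res := c.extendRes i
  born_inter j₁ j₂ k h := by
    obtain ⟨_, b₁, a₁, h₁⟩ := Incl.exists_isMeet i j₁
    obtain ⟨_, b₂, a₂, h₂⟩ := Incl.exists_isMeet i j₂
    obtain ⟨_, b, a, hk⟩ := Incl.exists_isMeet i k
    rw [extendBorn_iff h₁, extendBorn_iff h₂, extendBorn_iff hk]
    apply c.born_inter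
    have : i.emb '' Set.range b.emb = i.emb '' (Set.range b₁.emb ∩ Set.range b₂.emb) := by
      rw [← Incl.range_trans_inter, h₁.range_eq, h₂.range_eq, ← Incl.range_trans, hk.range_eq, h,
        Set.inter_inter_distrib_left]
    exact (Set.image_injective.2 i.emb.injective) this
  res_of_not_born j w h := by
    obtain ⟨_, b, a, hj⟩ := Incl.exists_isMeet i j
    rw [extendBorn_iff hj] at h
    rw [extendRes_iff hj]
    exact c.res_of_not_born _ _ h
  exists_prefix j h := by
    obtain ⟨_, b, a, hj⟩ := Incl.exists_isMeet i j
    rw [extendBorn_iff hj] at h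
    obtain ⟨V₀, p, hp⟩ := c.exists_prefix b h
    refine ⟨V₀, p.append (up a (nil _)), fun W w => ?_⟩
    rw [extendRes_iff hj, hp, append_assoc]
    rfl
  res_up k j w h := by
    obtain ⟨_, b, a, hj⟩ := Incl.exists_isMeet i j
    obtain ⟨_, b', a', hkj⟩ := Incl.exists_isMeet i (k.trans j)
    rw [extendRes_iff hj] at h
    rw [extendRes_iff hkj]
    obtain ⟨d, rfl, hd⟩ := hj.restrict k hkj
    refine c.res_of_refines (up_up_refines a' k w) ?_
    rw [← hd]
    exact c.res_of_refines (refines_up_up d a w) (c.res_up d b _ h)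
  res_of_up k j w w' hb h h' := by
    obtain ⟨_, b, a, hj⟩ := Incl.exists_isMeet i j
    obtain ⟨_, b', a', hkj⟩ := Incl.exists_isMeet i (k.trans j)
    rw [extendBorn_iff hkj] at hb
    rw [extendRes_iff hj] at h ⊢
    rw [extendRes_iff hkj] at h'
    obtain ⟨d, rfl, hd⟩ := hj.restrict k hkj
    refine c.res_of_up d b _ _ hb h ?_
    refine c.res_of_refines (up_up_refines d a w) ?_
    rw [hd]
    exact c.res_of_refines (refines_up_up a' k w) h'

/-- The initial cell, in which all events of `U` are active from the beginning, so that none of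
them can be removed. -/
def initial (L : PomLang α) (U : List α) : ResidualCell L U where
  born _ i := Function.Surjective i.emb
  res V _ i w := Function.Surjective i.emb → L.HasWord w
  born_inter i j k h := by
    rw [← Set.range_eq_univ, ← Set.range_eq_univ, ← Set.range_eq_univ, h, ← Set.univ_subset_iff,
      ← Set.univ_subset_iff, ← Set.univ_subset_iff, Set.subset_inter_iff]
  res_of_not_born i w h h' := (h h').elim
  exists_prefix i h := ⟨_, nil _, fun W w => ⟨fun hw => hw h, fun hw _ => hw⟩⟩
  res_up i j w h hs := by
    have hj : Function.Surjective j.emb := Function.Surjective.of_comp (g := i.emb) hs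
    have hi : Function.Surjective i.emb := fun x => by
      obtain ⟨y, hy⟩ := hs (j.emb x)
      exact ⟨y, j.emb.injective hy⟩
    obtain ⟨rfl, hi'⟩ := Sigma.mk.inj_iff.1 (i.eq_refl_of_surjective hi)
    obtain rfl := eq_of_heq hi'
    exact (h hj).of_refines (up_refl_refines w)
  res_of_up i j w w' hs _ h hj := by
    have hi : Function.Surjective i.emb := fun x => by
      obtain ⟨y, hy⟩ := hs (j.emb x)
      exact ⟨y, j.emb.injective hy⟩
    obtain ⟨rfl, hi'⟩ := Sigma.mk.inj_iff.1 (i.eq_refl_of_surjective hi)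
    obtain rfl := eq_of_heq hi'
    exact (h hs).of_refines (refines_up_refl w)

theorem eq_of_iff {c d : ResidualCell L U} (h1 : ∀ V (i : Incl V U), c.born V i ↔ d.born V i)
    (h2 : ∀ V W (i : Incl V U) (w : Word V W), c.res V W i w ↔ d.res V W i w) : c = d := by
  ext
  · exact h1 _ _
  · exact h2 _ _ _ _

theorem upperFace_refl (hL : L.SwapInvariant) (c : ResidualCell L U) :
    c.upperFace hL (Incl.refl U) = c := by
  refine eq_of_iff (fun V i => ?_) fun V W i w => ?_
  · exact upperBorn_iff (Incl.isAdjoin_refl_left i)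
  · refine (upperRes_iff (Incl.isAdjoin_refl_left i) w).trans ⟨?_, ?_⟩
    · exact c.res_of_refines (refines_down_refl w)
    · exact c.res_of_refines (down_refl_refines w)

theorem upperFace_upperFace (hL : L.SwapInvariant) {W V : List α} (j : Incl W V) (i : Incl V U)
    (c : ResidualCell L U) :
    (c.upperFace hL i).upperFace hL j = c.upperFace hL (j.trans i) := by
  refine eq_of_iff (fun T l => ?_) fun T Z l w => ?_
  · obtain ⟨K, k, m, h⟩ := Incl.exists_isAdjoin j l
    obtain ⟨K', k', m', h'⟩ := Incl.exists_isAdjoin i k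
    exact (upperBorn_iff h).trans ((upperBorn_iff h').trans (upperBorn_iff (h.trans h')).symm)
  · obtain ⟨K, k, m, h⟩ := Incl.exists_isAdjoin j l
    obtain ⟨K', k', m', h'⟩ := Incl.exists_isAdjoin i k
    refine (upperRes_iff h w).trans ((upperRes_iff h' _).trans
      (Iff.trans ?_ (upperRes_iff (h.trans h') w).symm))
    exact ⟨c.res_of_refines (refines_down_down m' m w),
      c.res_of_refines (down_down_refines m' m w)⟩

theorem upperFace_lowerFace (hL : L.SwapInvariant) {Z V W : List α} {i : Incl V U} {j : Incl W U}
    {j' : Incl Z V} {i' : Incl Z W} (hcomm : j'.trans i = i'.trans j)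
    (hunion : Set.range i.emb ∪ Set.range j.emb = Set.univ)
    (hinter : Set.range (j'.trans i).emb = Set.range i.emb ∩ Set.range j.emb)
    (c : ResidualCell L U) :
    (c.lowerFace i).upperFace hL j' = (c.upperFace hL j).lowerFace i' := by
  refine eq_of_iff (fun T l => ?_) fun T S l w => ?_
  · obtain ⟨K, k, m, h⟩ := Incl.exists_isAdjoin j' l
    exact (upperBorn_iff h).trans (upperBorn_iff (h.extend hcomm hunion hinter)).symm
  · obtain ⟨K, k, m, h⟩ := Incl.exists_isAdjoin j' l
    exact (upperRes_iff h w).trans (upperRes_iff (h.extend hcomm hunion hinter) w).symm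

theorem lowerFace_extend {V : List α} (i : Incl U V) (c : ResidualCell L U) :
    (c.extend i).lowerFace i = c := by
  refine eq_of_iff (fun W j => ?_) fun W T j w => ?_
  · exact extendBorn_iff (Incl.isMeet_trans_self i j)
  · refine (extendRes_iff (Incl.isMeet_trans_self i j) w).trans ⟨?_, ?_⟩
    · exact c.res_of_refines (refines_up_refl w)
    · exact c.res_of_refines (up_refl_refines w)

end ResidualCell

open ResidualCell

/-- The automaton of all residual cells of `L`. The only start cells are the initial ones, and a
cell is accepting if the run it stands for belongs to `L`. -/
def residualHDA (L : PomLang α) (hL : L.SwapInvariant) : HDA.{u, max u v} α where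
  cell U := ULift.{v} (ResidualCell L U)
  face ν _ _ i c := ⟨bif ν then c.down.upperFace hL i else c.down.lowerFace i⟩
  face_refl ν U c := by
    cases ν
    · rfl
    · exact congrArg ULift.up (upperFace_refl hL c.down)
  face_trans ν W V U j i c := by
    cases ν
    · rfl
    · exact congrArg ULift.up (upperFace_upperFace hL j i c.down)
  face_comm ν μ Z V W U i j j' i' h hunion hinter c := by
    refine congrArg ULift.up ?_
    cases ν <;> cases μ
    · change c.down.lowerFace (j'.trans i) = c.down.lowerFace (i'.trans j)
      rw [h]
    · exact upperFace_lowerFace hL h hunion hinter c.down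
    · exact (upperFace_lowerFace hL h.symm (Set.union_comm _ _ ▸ hunion)
        (by rw [← h, hinter, Set.inter_comm]) c.down).symm
    · change (c.down.upperFace hL i).upperFace hL j' = (c.down.upperFace hL j).upperFace hL i'
      rw [upperFace_upperFace, upperFace_upperFace, h]
  start U := {⟨initial L U⟩}
  accept U := {c | c.down.born U (Incl.refl U) ∧ c.down.res U U (Incl.refl U) (nil U)}

variable {L : PomLang α} (hL : L.SwapInvariant)

/-- Completions of the last cell of a path, preceded by the word of the path, are completions of
its first cell. -/
theorem residualHDA_along {U W : List α} {w : Word U W} {c : (residualHDA.{u, v} L hL).cell U}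
    {d : (residualHDA.{u, v} L hL).cell W} (h : (residualHDA.{u, v} L hL).Along w c d)
    (hc : c.down.born U (Incl.refl U)) : d.down.born W (Incl.refl W) ∧
      ∀ V (w' : Word W V), d.down.res W V (Incl.refl W) w' →
        c.down.res U V (Incl.refl U) (w.append w') := by
  induction w with
  | nil U =>
    obtain rfl := h
    exact ⟨hc, fun _ _ h => h⟩
  | up i w ih =>
    obtain ⟨z, rfl, h⟩ := h
    obtain ⟨h1, h2⟩ := ih h (z.down.born_of_trans i (Incl.refl _) hc)
    exact ⟨h1, fun V w' hw' => z.down.res_up i (Incl.refl _) _ (h2 V w' hw')⟩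
  | down i w ih =>
    obtain ⟨h1, h2⟩ := ih h ((upperBorn_iff (Incl.isAdjoin_refl_right i)).2 hc)
    exact ⟨h1, fun V w' hw' => (upperRes_iff (Incl.isAdjoin_refl_right i) _).1 (h2 V w' hw')⟩

/-- Every completion of the run that a cell stands for can be performed in the automaton. -/
theorem exists_residualHDA_along {U W : List α} (w : Word U W)
    (c : (residualHDA.{u, v} L hL).cell U)
    (hc : c.down.born U (Incl.refl U)) (hw : c.down.res U W (Incl.refl U) w) :
    ∃ d ∈ (residualHDA.{u, v} L hL).accept W, (residualHDA.{u, v} L hL).Along w c d := by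
  induction w with
  | nil U => exact ⟨c, ⟨hc, hw⟩, rfl⟩
  | up i w ih =>
    obtain ⟨d, hd, h⟩ := ih ⟨c.down.extend i⟩ ((extendBorn_iff (Incl.isMeet_refl i)).2 hc)
      ((extendRes_iff (Incl.isMeet_refl i) w).2 hw)
    exact ⟨d, hd, _, congrArg ULift.up (lowerFace_extend i c.down), h⟩
  | down i w ih =>
    obtain ⟨d, hd, h⟩ := ih ((residualHDA L hL).face true i c)
      ((upperBorn_iff (Incl.isAdjoin_refl_right i)).2 hc)
      ((upperRes_iff (Incl.isAdjoin_refl_right i) w).2 hw)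
    exact ⟨d, hd, h⟩

theorem residualHDA_lang : (residualHDA.{u, v} L hL).lang = L.carrier := by
  ext P
  obtain ⟨U, W, w, hw⟩ := P.exists_spells
  rw [HDA.mem_lang_iff hw, ← PomLang.hasWord_iff hw]
  constructor
  · rintro ⟨_, rfl, d, hd, h⟩
    have := (residualHDA_along hL h Function.surjective_id).2 _ _ hd.2 Function.surjective_id
    rwa [append_nil] at this
  · intro h
    obtain ⟨d, hd, h⟩ := exists_residualHDA_along hL w ⟨initial L U⟩ Function.surjective_id
      fun _ => h
    exact ⟨_, rfl, d, hd, h⟩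

theorem born_of_accessible {U : List α} {c : (residualHDA.{u, v} L hL).cell U}
    (h : (residualHDA.{u, v} L hL).Accessible c) : c.down.born U (Incl.refl U) := by
  obtain ⟨V, s, w, rfl, hw⟩ := HDA.accessible_iff.1 h
  exact (residualHDA_along hL hw Function.surjective_id).1

theorem exists_res_of_essential {U : List α} {c : (residualHDA.{u, v} L hL).cell U}
    (h : (residualHDA.{u, v} L hL).Essential c) :
    ∃ (W : List α) (w : Word U W), c.down.res U W (Incl.refl U) w := by
  obtain ⟨V, t, w, ht, hw⟩ := HDA.coaccessible_iff.1 h.2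
  exact ⟨V, _, (residualHDA_along hL hw (born_of_accessible hL h.1)).2 _ _ ht.2⟩

theorem residualHDA_deterministic : (residualHDA.{u, v} L hL).Deterministic := by
  refine ⟨?_, ?_⟩
  · rintro U _ rfl _ rfl
    rfl
  · intro U V i x hx y y' hy hy' hyx hyx'
    -- The data of `z` at `j` are recovered from those of `x` at the intersection of `i` and `j`.
    have key : ∀ z : (residualHDA.{u, v} L hL).cell V, (residualHDA L hL).Essential z →
        (residualHDA L hL).face false i z = x → ∀ (W : List α) (j : Incl W V) (Z : List α)
        (b : Incl Z U) (a : Incl Z W), Incl.IsMeet i j b a →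
        (z.down.born W j ↔ x.down.born Z b) ∧ ∀ (T : List α) (w : Word W T),
          z.down.res W T j w ↔ (x.down.born Z b → x.down.res Z T b (up a w)) := by
      rintro z hz rfl W j Z b a h
      have hi : z.down.born U i := born_of_accessible hL hx.1
      have hborn : z.down.born W j ↔ z.down.born Z (b.trans i) := by
        rw [z.down.born_inter i j (b.trans i) h.range_eq]
        exact ⟨fun hj => ⟨hi, hj⟩, fun hj => hj.2⟩
      refine ⟨hborn, fun T w => ⟨fun hw _ => ?_, fun hw => ?_⟩⟩
      · have := z.down.res_up a j w hw
        rw [h.comm] at this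
        exact this
      · by_cases hj : z.down.born W j
        · obtain ⟨W', w', hw'⟩ := exists_res_of_essential hL hz
          refine z.down.res_of_up a j w (up j w') ?_ (z.down.res_up j (Incl.refl V) w' hw') ?_
          · rw [h.comm]
            exact hborn.1 hj
          · rw [h.comm]
            exact hw (hborn.1 hj)
        · exact z.down.res_of_not_born j w hj
    refine ULift.ext _ _ (eq_of_iff (fun W j => ?_) fun W T j w => ?_)
    · obtain ⟨Z, b, a, h⟩ := Incl.exists_isMeet i j
      rw [(key y hy hyx W j Z b a h).1, (key y' hy' hyx' W j Z b a h).1]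
    · obtain ⟨Z, b, a, h⟩ := Incl.exists_isMeet i j
      rw [(key y hy hyx W j Z b a h).2, (key y' hy' hyx' W j Z b a h).2]

end Universal

end HDAut

theorem theorem2 {α : Type u} [Finite α] (L : HDAut.PomLang α) :
    (HDAut.PomLang.IsDeterministic.{u, max u v} L ↔ L.SwapInvariant) ∧
    (L.SwapInvariant ↔ ∀ P Q : HDAut.Iposet α, P.Subsumed Q →
      (L.prefixQuotient Q).Nonempty → L.prefixQuotient P = L.prefixQuotient Q) := by
  refine ⟨⟨?_, fun hL => ?_⟩, HDAut.PomLang.swapInvariant_iff⟩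
  · rintro ⟨X, hX, hL⟩
    exact hX.swapInvariant hL
  · exact ⟨HDAut.residualHDA.{u, v} L hL, HDAut.residualHDA_deterministic hL,
      HDAut.residualHDA_lang hL⟩
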